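/- Let $v_1,\dots,v_n\in\mathbb R^d$ ($n\ge 1$), $p\in\{1,2,\infty\}$, $\rho(i,j)=\|v_i-v_j\|_p$, $S=\{1,\dots,n\}$, and $\Delta(C)=\max_{x,y\in C}\rho(x,y)$. **Partitions.** A hierarchical partition with $L$ levels is a sequence $P=(P_0,\dots,P_L)$ of partitions of $S$ into cells with $P_L=\{S\}$ and $P_\ell$ a subdivision of $P_{\ell+1}$; $C_\ell(x)$ is the cell of $P_\ell$ containing $x$. For $a\in(0,1)$, $b,c>0$, $\gamma\ge 1$ put $\Delta_\ell=\gamma a^{L-\ell}\Delta(S)$. A probability distribution $\mathcal P$ over hierarchical partitions is $(a,b,c)$-distance-preserving with approximation $\gamma$ if in every $P$ in its support each cell of $P_{\ell+1}$ contains at most $c$ cells of $P_\ell$ and each cell of $P_\ell$ has diameter at most $\Delta_\ell$, and if $\Pr_{P\sim\mathcal P}[C_\ell(x)\ne C_\ell(y)]\le b\,\rho(x,y)/\Delta_\ell$ for all $x,y\in S$ and $0\le\ell\le L$ (with $0/0=0$). **Unit step.** For a cell $C\in P_\ell$, the input is a set $V(C)\subseteq C$ and a family $Q$ of connected components partitioning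 it. For $\ell=0$, $V(C)=C$ and all components are singletons; for $\ell\ge1$, $V(C)$ and $Q$ are the unions of the outputs of the cells of $P_{\ell-1}$ contained in $C$. While there is more than one component, find $u,v$ in different components with $\rho(u,v)\le(1+\epsilon)\tau$, where $\tau$ is the smallest distance between points of different components; if $\ell<L$ and $\rho(u,v)>\epsilon\Delta_\ell$, leave the loop; otherwise output the edge $(u,v)$ and merge the two components. Finally output a set $V'\subseteq V(C)$ such that each point of $C$ is within distance $\epsilon^2\Delta_\ell$ of $V'$, together with the partition of $V'$ induced by the components. All choices left open may be made arbitrarily. **Algorithm.** With constants $c_1,c_2>0$ and $\epsilon=\min\left(\frac{\eta}{6c_1Lb},\frac{\eta}{3c_2}\right)$, draw $k$ independent samples from $\mathcal P$, execute the unit step with parameter $\epsilon$ in all cells of each sample from level $0$ to level $L$, let $E$ be the set of all edges output, and return a minimum spanning tree of the graph $G=(S,E)$ with weights $\rho$. **Theorem.** (i) There are absolute constants $c_1,c_2>0$ such that for every $\kappa>0$ there is $K>0$ with the following property. For all $p\in\{1,2,\infty\}$, $d$, $n\ge1$, $v_1,\dots,v_n\in\mathbb R^d$, $0<\eta\le3$,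 $L\ge1$, $a\in(0,1)$, $b,c>0$, $\gamma\ge1$, every $\mathcal P$ with $L$ levels that is $(a,b,c)$-distance-preserving with approximation $\gamma$ for $\rho$, and every $k\ge K\log n$, with probability at least $1-n^{-\kappa}$ over the $k$ samples the following holds: the algorithm can be executed, and for every possible execution on these samples $G$ is connected and every minimum spanning tree of $G$ has, for all $1\le t\le n-1$, its $t$-th lightest edge of weight at most $(1+\eta)\,MST_t(\rho)$, where $MST_t(\rho)$ is the weight of the $t$-th lightest edge of a minimum spanning tree of the complete graph on $S$ with weights $\rho$. (ii) For $p\in\{1,2,\infty\}$, $n,d,L\ge1$ and every integer $m\ge2$, the randomly shifted grid is a $\left(\frac1m,d^2,(m+1)^d\right)$-distance-preserving family with $L$ levels and some approximation $\gamma\le d$. Here the points are translated into $[0,\Delta]^d$ with $\Delta=\max_{i,j}\|v_i-v_j\|_\infty$, $r$ is uniform in $[0,\Delta]^d$, $P_L=\{S\}$, and for $\ell<L$ two points $u,v$ share a cell of $P_\ell$ iff $\left\lfloor\frac{(u_i-r_i)m^{L-\ell}}{\Delta}\right\rfloor=\left\lfloor\frac{(v_i-r_i)m^{L-\ell}}{\Delta}\right\rfloor$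 for all $i$. (With $m=s^{\alpha/d}-1$ these are the parameters $a=1/(s^{\alpha/d}-1)$, $b=\mathrm{poly}(d)$, $c=s^\alpha$ of the algorithm.) -/

import Mathlib

open scoped ENNReal

/-! Hierarchical partitions of a finite ground set, the level-by-level spanning tree construction
on such a partition, and minimum spanning trees of finite weighted graphs. -/

namespace PartitionMST

/-! ### Hierarchical partitions -/

/-- A deterministic hierarchical partition `(P_0, …, P_L)` of a finite set: `P_L` has the whole set
as its only cell, and each `P_ℓ` subdivides `P_{ℓ+1}`. -/
structure HierPartition (V : Type) [Fintype V] [DecidableEq V] (L : ℕ) where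
  level : Fin (L + 1) → Finpartition (Finset.univ : Finset V)
  root : (level (Fin.last L)).parts = {Finset.univ}
  subdivides : ∀ ℓ : Fin L, level ℓ.castSucc ≤ level ℓ.succ

section Partition

variable {V : Type} [Fintype V] [DecidableEq V] {L : ℕ}

/-- There are finitely many deterministic hierarchical partitions; all events are measurable. -/
instance : MeasurableSpace (HierPartition V L) := ⊤

/-- The cells of `P_ℓ` contained in the set `C` (for `C` a cell of `P_{ℓ+1}`, its subcells). -/
def HierPartition.children (P : HierPartition V L) (ℓ : Fin L) (C : Finset V) :
    Finset (Finset V) :=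
  (P.level ℓ.castSucc).parts.filter (fun C' => C' ⊆ C)

/-- The diameter `Δ(C)` of a set of points. -/
noncomputable def diam (ρ : V → V → ℝ) (C : Finset V) : ℝ :=
  ⨆ q : C × C, ρ q.1 q.2

/-- The scale `Δ_ℓ = γ a^(L-ℓ) Δ(S)`. -/
noncomputable def scale (ρ : V → V → ℝ) (a γ : ℝ) (L : ℕ) (ℓ : Fin (L + 1)) : ℝ :=
  γ * a ^ (L - (ℓ : ℕ)) * diam ρ Finset.univ

/-- A randomized hierarchical partition (a probability distribution over the finitely many
deterministic ones) that is `(a,b,c)`-distance-preserving with approximation `γ`. -/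
structure IsDistancePreserving (ρ : V → V → ℝ) (D : MeasureTheory.Measure (HierPartition V L))
    (a b c γ : ℝ) : Prop where
  prob : MeasureTheory.IsProbabilityMeasure D
  a_pos : 0 < a
  a_lt_one : a < 1
  b_pos : 0 < b
  c_pos : 0 < c
  one_le_γ : 1 ≤ γ
  degree : ∀ P, D {P} ≠ 0 → ∀ ℓ : Fin L, ∀ C ∈ (P.level ℓ.succ).parts,
    ((P.children ℓ C).card : ℝ) ≤ c
  bounded_diam : ∀ P, D {P} ≠ 0 → ∀ ℓ, ∀ C ∈ (P.level ℓ).parts, diam ρ C ≤ scale ρ a γ L ℓ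
  cut_prob : ∀ (x y : V) (ℓ : Fin (L + 1)),
    D.real {P | (P.level ℓ).part x ≠ (P.level ℓ).part y} ≤ b * (ρ x y / scale ρ a γ L ℓ)

/-! ### The unit step and its execution on all cells -/

/-- The loop of the unit step. `MergeLoop ρ ε θ Q E Q'` says that the loop, started from the
family `Q` of connected components, with slack `ε` and length threshold `θ`, can output the tree
edges `E` and stop with the components `Q'`. In each iteration, any pair `u, v` of points in
different components whose distance is within `1 + ε` of the smallest such distance may be found. -/
inductive MergeLoop (ρ : V → V → ℝ) (ε : ℝ) (θ : WithTop ℝ) :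
    Finset (Finset V) → Finset (Sym2 V) → Finset (Finset V) → Prop
  | single (Q : Finset (Finset V)) (hQ : Q.card ≤ 1) : MergeLoop ρ ε θ Q ∅ Q
  | halt (Q : Finset (Finset V)) (A B : Finset V) (u v : V)
      (hA : A ∈ Q) (hB : B ∈ Q) (hAB : A ≠ B) (hu : u ∈ A) (hv : v ∈ B)
      (near : ∀ A' ∈ Q, ∀ B' ∈ Q, A' ≠ B' → ∀ u' ∈ A', ∀ v' ∈ B',
        ρ u v ≤ (1 + ε) * ρ u' v')
      (long : θ < (ρ u v : WithTop ℝ)) : MergeLoop ρ ε θ Q ∅ Q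
  | merge (Q : Finset (Finset V)) (A B : Finset V) (u v : V)
      (E : Finset (Sym2 V)) (Q' : Finset (Finset V))
      (hA : A ∈ Q) (hB : B ∈ Q) (hAB : A ≠ B) (hu : u ∈ A) (hv : v ∈ B)
      (near : ∀ A' ∈ Q, ∀ B' ∈ Q, A' ≠ B' → ∀ u' ∈ A', ∀ v' ∈ B',
        ρ u v ≤ (1 + ε) * ρ u' v')
      (short : (ρ u v : WithTop ℝ) ≤ θ)
      (rest : MergeLoop ρ ε θ (insert (A ∪ B) ((Q.erase A).erase B)) E Q') :
      MergeLoop ρ ε θ Q (insert s(u, v) E) Q'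

/-- One unit step in a cell `C`, with input points `W` and components `Q`, threshold `θ` and
covering radius `δ`: it outputs tree edges `E`, a `δ`-covering `W' ⊆ W` of `C`, and the
partition `Q'` of `W'` induced by the final components. -/
def UnitStep (ρ : V → V → ℝ) (ε : ℝ) (θ : WithTop ℝ) (δ : ℝ) (C W : Finset V)
    (Q : Finset (Finset V)) (E : Finset (Sym2 V)) (W' : Finset V) (Q' : Finset (Finset V)) :
    Prop :=
  ∃ R : Finset (Finset V), MergeLoop ρ ε θ Q E R ∧
    W' ⊆ W ∧ (∀ x ∈ C, ∃ y ∈ W', ρ x y ≤ δ) ∧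
    Q' = (R.image (fun A => A ∩ W')).erase ∅

/-- The input points of the unit step in the cell `C` of level `ℓ`: all points of `C` at the bottom
level, and the union of the outputs `net` of the subcells at higher levels. -/
def inputPoints (P : HierPartition V L) (net : Fin (L + 1) → Finset V → Finset V)
    (ℓ : Fin (L + 1)) (C : Finset V) : Finset V :=
  Fin.cases C (fun j => (P.children j C).biUnion (net j.castSucc)) ℓ

/-- The input components of the unit step in the cell `C` of level `ℓ`: singletons at the bottom
level, and the union of the outputs `comps` of the subcells at higher levels. -/
def inputComps (P : HierPartition V L) (comps : Fin (L + 1) → Finset V → Finset (Finset V))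
    (ℓ : Fin (L + 1)) (C : Finset V) : Finset (Finset V) :=
  Fin.cases (C.image (fun x => {x})) (fun j => (P.children j C).biUnion (comps j.castSucc)) ℓ

/-- The length threshold at level `ℓ`: `ε Δ_ℓ` below the root; in the root cell the loop runs until
a single component is left. -/
noncomputable def threshold (ε : ℝ) (Δ : Fin (L + 1) → ℝ) (ℓ : Fin (L + 1)) : WithTop ℝ :=
  if ℓ = Fin.last L then ⊤ else ((ε * Δ ℓ : ℝ) : WithTop ℝ)

/-- A possible execution of the unit steps in all cells of the hierarchical partition `P`, from the
bottom level to the root, with scales `Δ`. -/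
structure Execution (ρ : V → V → ℝ) (ε : ℝ) (Δ : Fin (L + 1) → ℝ) (P : HierPartition V L) where
  edges : Fin (L + 1) → Finset V → Finset (Sym2 V)
  net : Fin (L + 1) → Finset V → Finset V
  comps : Fin (L + 1) → Finset V → Finset (Finset V)
  step : ∀ ℓ, ∀ C ∈ (P.level ℓ).parts,
    UnitStep ρ ε (threshold ε Δ ℓ) (ε ^ 2 * Δ ℓ) C (inputPoints P net ℓ C)
      (inputComps P comps ℓ C) (edges ℓ C) (net ℓ C) (comps ℓ C)

/-- All tree edges output during an execution. -/
def Execution.outputEdges {ρ : V → V → ℝ} {ε : ℝ} {Δ : Fin (L + 1) → ℝ} {P : HierPartition V L}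
    (R : Execution ρ ε Δ P) : Set (Sym2 V) :=
  {e | ∃ ℓ, ∃ C ∈ (P.level ℓ).parts, e ∈ R.edges ℓ C}

/-- The graph formed by the edges collected over all repetitions. -/
def unionGraph {ρ : V → V → ℝ} {ε : ℝ} {Δ : Fin (L + 1) → ℝ} {k : ℕ}
    {P : Fin k → HierPartition V L} (R : ∀ i, Execution ρ ε Δ (P i)) : SimpleGraph V :=
  SimpleGraph.fromEdgeSet (⋃ i, (R i).outputEdges)

end Partition

/-! ### Minimum spanning trees -/

section MST

variable {V : Type} [Fintype V]

/-- The multiset of the edge weights of a graph. -/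
noncomputable def edgeWeights (w : Sym2 V → ℝ) (T : SimpleGraph V) : Multiset ℝ :=
  (Set.toFinite T.edgeSet).toFinset.val.map w

/-- `T` is a minimum spanning tree of `G` with respect to the edge weights `w`. -/
def IsMST (w : Sym2 V → ℝ) (G T : SimpleGraph V) : Prop :=
  T ≤ G ∧ T.IsTree ∧
    ∀ T' : SimpleGraph V, T' ≤ G → T'.IsTree → (edgeWeights w T).sum ≤ (edgeWeights w T').sum

/-- The edge weights in non-decreasing order. -/
noncomputable def sortedWeights (w : Sym2 V → ℝ) (T : SimpleGraph V) : List ℝ :=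
  (edgeWeights w T).sort (· ≤ ·)

end MST

/-! ### Point sets in `ℓ_p^d` -/

section Points

variable {p : ℝ≥0∞} [Fact (1 ≤ p)] {d n L : ℕ}

/-- The distance function of the points `v_1, …, v_n`. -/
noncomputable def pointDist (v : Fin n → PiLp p (fun _ : Fin d => ℝ)) (i j : Fin n) : ℝ :=
  dist (v i) (v j)

/-- The distance as a weight function on the edges of the complete graph. -/
noncomputable def pointWeight (v : Fin n → PiLp p (fun _ : Fin d => ℝ)) : Sym2 (Fin n) → ℝ :=
  Sym2.lift ⟨pointDist v, fun i j => dist_comm (v i) (v j)⟩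

/-- The algorithm with sampled partitions `P_1, …, P_k` succeeds with approximation `1 + η`: it
always produces an output, and for every possible execution on these partitions the graph `G` of
all collected edges is connected, and every minimum spanning tree `T` of `G` has, for every `t`,
its `t`-th lightest edge of weight at most `1 + η` times that of the `t`-th lightest edge of a
minimum spanning tree of the complete distance graph. -/
def Succeeds (v : Fin n → PiLp p (fun _ : Fin d => ℝ)) (ε : ℝ) (Δ : Fin (L + 1) → ℝ) (η : ℝ)
    {k : ℕ} (P : Fin k → HierPartition (Fin n) L) : Prop :=
  (∀ i, Nonempty (Execution (pointDist v) ε Δ (P i))) ∧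
  ∀ R : ∀ i, Execution (pointDist v) ε Δ (P i),
    (unionGraph R).Connected ∧
    ∀ T, IsMST (pointWeight v) (unionGraph R) T →
      ∀ T₀, IsMST (pointWeight v) ⊤ T₀ →
        List.Forall₂ (fun x y => x ≤ (1 + η) * y)
          (sortedWeights (pointWeight v) T) (sortedWeights (pointWeight v) T₀)

/-! ### The randomly shifted grid -/

/-- The diameter of the point set in the maximum norm. -/
noncomputable def supDiam (v : Fin n → PiLp p (fun _ : Fin d => ℝ)) : ℝ :=
  diam (fun i j => dist (WithLp.ofLp (v i)) (WithLp.ofLp (v j))) Finset.univ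

/-- The index of the grid cell of the point `v x`. The points are first translated into the box
`[0, Δ]^d`, where `Δ` is the diameter in the maximum norm; the random shift is `r = Δ ω`; the
cells have side length `Δ / m ^ j`. -/
noncomputable def gridIndex (v : Fin n → PiLp p (fun _ : Fin d => ℝ)) (m j : ℕ)
    (ω : Fin d → unitInterval) (x : Fin n) : Fin d → ℤ :=
  fun i => ⌊(v x i - (⨅ y, v y i) - supDiam v * (ω i : ℝ)) * (m : ℝ) ^ j / supDiam v⌋

/-- Being in the same cell at level `ℓ`; the root level has one cell. -/
def gridSetoid (v : Fin n → PiLp p (fun _ : Fin d => ℝ)) (m : ℕ) (ω : Fin d → unitInterval)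
    (ℓ : Fin (L + 1)) : Setoid (Fin n) where
  r x y := ℓ = Fin.last L ∨ gridIndex v m (L - (ℓ : ℕ)) ω x = gridIndex v m (L - (ℓ : ℕ)) ω y
  iseqv := ⟨fun _ => Or.inr rfl, fun h => h.imp_right Eq.symm, fun h h' => by
    rcases h with h | h
    · exact Or.inl h
    · rcases h' with h' | h'
      · exact Or.inl h'
      · exact Or.inr (h.trans h')⟩

theorem gridIndex_succ (v : Fin n → PiLp p (fun _ : Fin d => ℝ)) (m j : ℕ) (hm : m ≠ 0)
    (ω : Fin d → unitInterval) (x : Fin n) (i : Fin d) :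
    gridIndex v m j ω x i = gridIndex v m (j + 1) ω x i / (m : ℤ) := by
  unfold gridIndex
  rw [← Int.floor_div_natCast]
  congr 1
  have : (m : ℝ) ≠ 0 := by exact_mod_cast hm
  rw [pow_succ]
  field_simp

theorem gridSetoid_mono (v : Fin n → PiLp p (fun _ : Fin d => ℝ)) (m : ℕ) (hm : m ≠ 0)
    (ω : Fin d → unitInterval) (ℓ : Fin L) (x y : Fin n)
    (h : gridSetoid v m ω ℓ.castSucc x y) : gridSetoid v m ω ℓ.succ x y := by
  rcases h with h | h
  · exact absurd h (Fin.castSucc_lt_last ℓ).ne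
  · right
    have hj : L - (ℓ.castSucc : ℕ) = (L - (ℓ.succ : ℕ)) + 1 := by
      have := ℓ.isLt
      simp only [Fin.val_castSucc, Fin.val_succ]
      omega
    rw [hj] at h
    funext i
    rw [gridIndex_succ v m _ hm ω x i, gridIndex_succ v m _ hm ω y i, h]

open Classical in
/-- The hierarchical partition given by nested grids with shift parameter `ω`. -/
noncomputable def gridPartition [NeZero n] (v : Fin n → PiLp p (fun _ : Fin d => ℝ)) (m L : ℕ)
    [NeZero m] (ω : Fin d → unitInterval) : HierPartition (Fin n) L where
  level ℓ := Finpartition.ofSetoid (gridSetoid v m ω ℓ)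
  root := by
    have hpart : ∀ x, (Finpartition.ofSetoid (gridSetoid v m ω (Fin.last L))).part x
        = Finset.univ := by
      intro x
      ext y
      rw [Finpartition.mem_part_ofSetoid_iff_rel]
      simp only [Finset.mem_univ, iff_true]
      exact Or.inl rfl
    ext C
    rw [Finset.mem_singleton]
    constructor
    · intro hC
      obtain ⟨x, hx⟩ := Finpartition.nonempty_of_mem_parts _ hC
      rw [← Finpartition.part_eq_of_mem _ hC hx, hpart]
    · rintro rfl
      have h := ((Finpartition.ofSetoid (gridSetoid v m ω (Fin.last L))).part_mem
        (a := (0 : Fin n))).2 (Finset.mem_univ _)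
      rwa [hpart] at h
  subdivides ℓ := by
    intro C hC
    obtain ⟨x, hx⟩ := Finpartition.nonempty_of_mem_parts _ hC
    refine ⟨(Finpartition.ofSetoid (gridSetoid v m ω ℓ.succ)).part x,
      (Finpartition.part_mem _).2 (Finset.mem_univ _), fun y hy => ?_⟩
    rw [← Finpartition.part_eq_of_mem _ hC hx, Finpartition.mem_part_ofSetoid_iff_rel] at hy
    rw [Finpartition.mem_part_ofSetoid_iff_rel]
    exact gridSetoid_mono v m (NeZero.ne m) ω ℓ x y hy

/-- The distribution of the grid partition for a uniformly random shift. -/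
noncomputable def gridDistribution [NeZero n] (v : Fin n → PiLp p (fun _ : Fin d => ℝ)) (m L : ℕ)
    [NeZero m] : MeasureTheory.Measure (HierPartition (Fin n) L) :=
  (MeasureTheory.volume : MeasureTheory.Measure (Fin d → unitInterval)).map (gridPartition v m L)

end Points

end PartitionMST

namespace PartitionMST

/-! Part (i) reduces to one statement about pairs: every `x, y` should be joined in the collected
graph by edges of length at most `M = (1 + η) ρ(x, y)`. A minimum spanning tree preserves
connectivity in every sublevel of the weights (exchange argument), and comparing the number of edges
in sublevels turns the pairwise statement into the comparison of the `t`-th lightest edges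
(`IsMST.forall₂_sortedWeights`).

For a fixed pair, take the first level `ℓ` whose threshold is at least `M`; the root qualifies
because its threshold is infinite. All levels below have thresholds less than `M`, so every edge
output there is short enough to use. If `x` and `y` share a cell of level `ℓ`, each is joined by
such edges to an input point of that cell within `ε² Δ_{ℓ-1} ≤ ε M`. As long as these two input
points `u, v` lie in different components, the edge selected by the loop has length at most `(1 + ε)
ρ(u, v) ≤ M`, hence the loop does not stop and merges only along edges of length at most `M` until
they meet (`Execution.rel_of_part_eq`). Connectivity is handled through an arbitrary equivalence
relation `r`, later taken to be reachability in the sublevel graph.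

The level `ℓ` depends on the pair but not on the sample. Below the root, `ρ(x, y) ≤ M ≤ ε Δ_ℓ`, so
one sample cuts the pair with probability at most `b ε ≤ 1/2`; at the root it is never cut.
Independence and a union bound over `n²` pairs give failure probability at most `n² 2^{-k}`.

For part (ii), a random shift separates two reals with probability at most their distance in grid
widths, since the difference of their floors has exactly that mean. Summing over coordinates bounds
the cut probability by an `ℓ_1` distance, and comparison of the `ℓ_1`, `ℓ_p` and `ℓ_∞` norms gives
the parameters with `γ = d`. -/

/-- The spanning subgraph of the edges of `G` of weight at most `s`. -/
def sublevel {V : Type} (w : Sym2 V → ℝ) (G : SimpleGraph V) (s : ℝ) : SimpleGraph V :=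
  SimpleGraph.fromEdgeSet {e | e ∈ G.edgeSet ∧ w e ≤ s}

/-! ### Minimum spanning trees and sublevels of the weight -/

section Graph

variable {V : Type} {w : Sym2 V → ℝ} {G T T₀ : SimpleGraph V} {s : ℝ}

theorem edgeSet_sublevel (w : Sym2 V → ℝ) (G : SimpleGraph V) (s : ℝ) :
    (sublevel w G s).edgeSet = {e | e ∈ G.edgeSet ∧ w e ≤ s} := by
  rw [sublevel, SimpleGraph.edgeSet_fromEdgeSet, sdiff_eq_left]
  exact Set.disjoint_left.2 fun e he hd => G.not_isDiag_of_mem_edgeSet he.1 hd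

theorem sublevel_le (w : Sym2 V → ℝ) (G : SimpleGraph V) (s : ℝ) : sublevel w G s ≤ G := by
  rw [← SimpleGraph.edgeSet_subset_edgeSet, edgeSet_sublevel]
  exact fun e he => he.1

theorem sublevel_adj {x y : V} : (sublevel w G s).Adj x y ↔ G.Adj x y ∧ w s(x, y) ≤ s := by
  rw [← SimpleGraph.mem_edgeSet, edgeSet_sublevel]
  rfl

theorem sublevel_mono {s t : ℝ} (h : s ≤ t) : sublevel w G s ≤ sublevel w G t := by
  intro x y hxy
  rw [sublevel_adj] at *
  exact ⟨hxy.1, hxy.2.trans h⟩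

theorem reachable_of_adj_reachable {H K : SimpleGraph V}
    (h : ∀ x y, H.Adj x y → K.Reachable x y) {x y : V} (hxy : H.Reachable x y) :
    K.Reachable x y := by
  obtain ⟨p⟩ := hxy
  induction p with
  | nil => exact SimpleGraph.Reachable.refl _
  | cons hadj _ ih => exact (h _ _ hadj).trans ih

variable [Fintype V]

theorem sum_edgeWeights (w : Sym2 V → ℝ) (T : SimpleGraph V) :
    (edgeWeights w T).sum = ∑ e ∈ (Set.toFinite T.edgeSet).toFinset, w e := rfl

theorem card_toFinset_edgeSet_of_isTree (hT : T.IsTree) :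
    (Set.toFinite T.edgeSet).toFinset.card + 1 = Nat.card V := by
  rw [← (SimpleGraph.isTree_iff_connected_and_card.1 hT).2, ← Set.ncard_eq_toFinset_card,
    Nat.card_coe_set_eq]

/-- Within each sublevel of the weights, a minimum spanning tree connects what the graph does. -/
theorem IsMST.sublevel_reachable (hT : IsMST w G T) {x y : V}
    (h : (sublevel w G s).Reachable x y) : (sublevel w T s).Reachable x y := by
  classical
  refine reachable_of_adj_reachable (fun x y hxy => ?_) h
  by_contra hn
  obtain ⟨hG, hs⟩ := sublevel_adj.1 hxy
  obtain ⟨hTG, htree, hmin⟩ := hT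
  have hne : x ≠ y := hG.ne
  have hTn : ¬ T.Adj x y := fun hadj =>
    hn (SimpleGraph.Adj.reachable (sublevel_adj.2 ⟨hadj, hs⟩))
  -- Exchange: the light part of `T` together with `xy` is a forest, so it extends to a spanning
  -- tree `T'` inside `T + xy`.
  have hacyc : (sublevel w T s ⊔ SimpleGraph.edge x y).IsAcyclic :=
    (htree.isAcyclic.anti (sublevel_le w T s)).sup_edge_of_not_reachable hn
  obtain ⟨T', hT', hT'1, hT'2⟩ :=
    (htree.connected.mono (le_sup_left : T ≤ T ⊔ SimpleGraph.edge x y)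
      ).exists_isTree_le_of_le_of_isAcyclic (sup_le_sup_right (sublevel_le w T s) _) hacyc
  have hedge : SimpleGraph.edge x y ≤ G := by
    rw [SimpleGraph.edge_le_iff]
    exact Or.inr hG
  have hle := hmin T' (hT'1.trans (sup_le hTG hedge)) hT'2
  rw [sum_edgeWeights, sum_edgeWeights] at hle
  have hc := card_toFinset_edgeSet_of_isTree htree
  have hc' := card_toFinset_edgeSet_of_isTree hT'2
  set A := (Set.toFinite T.edgeSet).toFinset with hA
  set A' := (Set.toFinite T'.edgeSet).toFinset with hA'
  have heA : s(x, y) ∉ A := by simpa [hA] using hTn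
  have hsub : A' ⊆ insert s(x, y) A := by
    intro e he
    induction e with | _ u v
    have hadj : T'.Adj u v := by simpa [hA'] using he
    have h2 := hT'1 hadj
    rw [SimpleGraph.sup_adj, SimpleGraph.edge_adj] at h2
    rw [Finset.mem_insert]
    rcases h2 with h2 | h2
    · right
      simpa [hA] using h2
    · left
      simp only [Sym2.eq_iff]
      tauto
  -- By counting, `T'` omits exactly one edge `f` of `T + xy`. It keeps the light part and `xy`, so
  -- `w f > s ≥ w(xy)`, and `T'` is strictly lighter than `T`.
  have hcard : (insert s(x, y) A \ A').card = 1 := by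
    rw [Finset.card_sdiff_of_subset hsub, Finset.card_insert_of_notMem heA]
    omega
  obtain ⟨f, hf⟩ := Finset.card_eq_one.1 hcard
  have hf' : f ∈ insert s(x, y) A \ A' := hf ▸ Finset.mem_singleton_self f
  rw [Finset.mem_sdiff, Finset.mem_insert] at hf'
  have hwf : s < w f := by
    by_contra hle
    apply hf'.2
    have hmem : f ∈ (sublevel w T s ⊔ SimpleGraph.edge x y).edgeSet := by
      rw [SimpleGraph.edgeSet_sup]
      rcases hf'.1 with rfl | hfA
      · right
        simp [hne]
      · left
        rw [edgeSet_sublevel]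
        exact ⟨by simpa [hA] using hfA, not_lt.1 hle⟩
    simpa [hA'] using SimpleGraph.edgeSet_subset_edgeSet.2 hT' hmem
  have hsum := Finset.sum_sdiff (f := w) hsub
  rw [hf, Finset.sum_singleton, Finset.sum_insert heA] at hsum
  linarith

theorem countP_sortedWeights (w : Sym2 V → ℝ) (T : SimpleGraph V) (s : ℝ) :
    (sortedWeights w T).countP (fun x => x ≤ s) =
      (Set.toFinite (sublevel w T s).edgeSet).toFinset.card := by
  classical
  rw [← Multiset.coe_countP, sortedWeights, Multiset.sort_eq, edgeWeights, Multiset.countP_map,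
    ← Finset.filter_val, ← Finset.card_def]
  congr 1
  ext e
  simp [edgeSet_sublevel]

/-- If each edge of a tree `T₀` joins vertices connected by edges of `T` in a sublevel, then the
sublevel of `T` has at least as many edges as that of `T₀`. -/
theorem card_sublevel_le (hT₀ : T₀.IsTree) {s t : ℝ}
    (h : ∀ x y, T₀.Adj x y → w s(x, y) ≤ s → (sublevel w T t).Reachable x y) :
    (Set.toFinite (sublevel w T₀ s).edgeSet).toFinset.card ≤
      (Set.toFinite (sublevel w T t).edgeSet).toFinset.card := by
  classical
  -- Replacing the light edges of `T₀` by the sublevel of `T` keeps the graph connected, so at least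
  -- as many edges were added as removed.
  have hcon : ((T₀ \ sublevel w T₀ s) ⊔ sublevel w T t).Connected := by
    have := hT₀.connected.nonempty
    refine ⟨fun x y => reachable_of_adj_reachable (fun x y hxy => ?_) (hT₀.connected x y)⟩
    by_cases hs : w s(x, y) ≤ s
    · exact (h x y hxy hs).mono le_sup_right
    · refine SimpleGraph.Adj.reachable (Or.inl ⟨hxy, fun h' => hs (sublevel_adj.1 h').2⟩)
  have h1 := hcon.card_vert_le_card_edgeSet_add_one
  have h2 := (SimpleGraph.isTree_iff_connected_and_card.1 hT₀).2
  rw [Nat.card_coe_set_eq] at h1 h2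
  rw [← Set.ncard_eq_toFinset_card, ← Set.ncard_eq_toFinset_card]
  rw [SimpleGraph.edgeSet_sup, SimpleGraph.edgeSet_sdiff] at h1
  have h3 := Set.ncard_union_le (T₀.edgeSet \ (sublevel w T₀ s).edgeSet) (sublevel w T t).edgeSet
  have h4 := Set.ncard_sdiff_add_ncard_of_subset
    (SimpleGraph.edgeSet_subset_edgeSet.2 (sublevel_le w T₀ s))
  omega

/-- If `l[i] > c * l₀[i]`, then at most `i` entries of `l` are at most `c * l₀[i]`, whereas at least
`i + 1` entries of `l₀` are at most `l₀[i]`; the count at `s = l₀[i]` is violated. -/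
theorem forall₂_of_countP_le {l l₀ : List ℝ} {c : ℝ} (hl : l.Pairwise (· ≤ ·))
    (hl₀ : l₀.Pairwise (· ≤ ·)) (hlen : l.length = l₀.length)
    (h : ∀ s, l₀.countP (fun x => x ≤ s) ≤ l.countP (fun x => x ≤ c * s)) :
    List.Forall₂ (fun x y => x ≤ c * y) l l₀ := by
  rw [List.forall₂_iff_get]
  refine ⟨hlen, fun i hi hi₀ => ?_⟩
  simp only [List.get_eq_getElem]
  by_contra hlt
  rw [not_le] at hlt
  have h1 : i + 1 ≤ l₀.countP (fun x => x ≤ l₀[i]) := by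
    refine le_trans ?_ ((List.take_sublist (i + 1) l₀).countP_le)
    have hall : (l₀.take (i + 1)).countP (fun x => decide (x ≤ l₀[i])) =
        (l₀.take (i + 1)).length := by
      rw [List.countP_eq_length]
      intro x hx
      obtain ⟨j, hj, rfl⟩ := List.mem_iff_getElem.1 hx
      simp only [List.getElem_take, decide_eq_true_eq]
      rw [List.length_take] at hj
      rcases eq_or_lt_of_le (show j ≤ i by omega) with rfl | hji
      · exact le_rfl
      · exact List.pairwise_iff_getElem.1 hl₀ _ _ _ _ hji
    rw [hall, List.length_take]
    omega
  have h2 : l.countP (fun x => x ≤ c * l₀[i]) ≤ i := by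
    generalize c * l₀[i] = z at hlt
    have hz : (l.drop i).countP (fun x => decide (x ≤ z)) = 0 := by
      rw [List.countP_eq_zero]
      intro x hx
      obtain ⟨j, hj, rfl⟩ := List.mem_iff_getElem.1 hx
      simp only [List.getElem_drop, decide_eq_true_eq, not_le]
      refine hlt.trans_le ?_
      rcases Nat.eq_zero_or_pos j with rfl | hj0
      · simp
      · exact List.pairwise_iff_getElem.1 hl _ _ _ _ (by omega)
    rw [← List.take_append_drop i l, List.countP_append, hz]
    exact List.countP_le_length.trans (by rw [List.length_take]; omega)
  have := h l₀[i]
  omega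

/-- If every pair is connected in `G` by edges of weight at most `c` times its own weight, then
the edge weights of a minimum spanning tree of `G` are, rank by rank, at most `c` times those of
any spanning tree. -/
theorem IsMST.forall₂_sortedWeights {c : ℝ} (hc : 0 ≤ c) (hT : IsMST w G T) (hT₀ : T₀.IsTree)
    (h : ∀ x y, (sublevel w G (c * w s(x, y))).Reachable x y) :
    List.Forall₂ (fun x y => x ≤ c * y) (sortedWeights w T) (sortedWeights w T₀) := by
  have hlen : ∀ T : SimpleGraph V,
      (sortedWeights w T).length = (Set.toFinite T.edgeSet).toFinset.card := by
    intro T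
    simp [sortedWeights, edgeWeights]
  refine forall₂_of_countP_le (Multiset.pairwise_sort _ _) (Multiset.pairwise_sort _ _) ?_
    fun s => ?_
  · have h1 := card_toFinset_edgeSet_of_isTree hT.2.1
    have h2 := card_toFinset_edgeSet_of_isTree hT₀
    rw [hlen, hlen]
    omega
  · rw [countP_sortedWeights, countP_sortedWeights]
    refine card_sublevel_le hT₀ fun x y _ hs => hT.sublevel_reachable ?_
    exact (h x y).mono (sublevel_mono (mul_le_mul_of_nonneg_left hs hc))

end Graph

/-! ### The merging loop and a single unit step -/

section Loop

variable {V : Type} [DecidableEq V] {ρ : V → V → ℝ} {ε : ℝ} {θ : WithTop ℝ}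
  {Q Q' : Finset (Finset V)} {E : Finset (Sym2 V)}

/-- Any two points of the same component are related by `r`. -/
def Linked (r : Setoid V) (Q : Finset (Finset V)) : Prop :=
  ∀ A ∈ Q, ∀ u ∈ A, ∀ v ∈ A, r u v

theorem Linked.merge {r : Setoid V} (h : Linked r Q) {A B : Finset V} (hA : A ∈ Q) (hB : B ∈ Q)
    {u v : V} (hu : u ∈ A) (hv : v ∈ B) (huv : r u v) :
    Linked r (insert (A ∪ B) ((Q.erase A).erase B)) := by
  have key : ∀ x ∈ A ∪ B, r x u := by
    intro x hx
    rcases Finset.mem_union.1 hx with hx | hx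
    · exact h A hA x hx u hu
    · exact r.trans (h B hB x hx v hv) (r.symm huv)
  intro C hC x hx y hy
  rcases Finset.mem_insert.1 hC with rfl | hC
  · exact r.trans (key x hx) (r.symm (key y hy))
  · exact h C (Finset.mem_of_mem_erase (Finset.mem_of_mem_erase hC)) x hx y hy

theorem exists_mem_merge {A B C : Finset V} (hC : C ∈ Q) {x : V} (hx : x ∈ C) :
    ∃ C' ∈ insert (A ∪ B) ((Q.erase A).erase B), x ∈ C' := by
  by_cases hCA : C = A
  · exact ⟨_, Finset.mem_insert_self _ _, Finset.mem_union_left _ (hCA ▸ hx)⟩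
  · by_cases hCB : C = B
    · exact ⟨_, Finset.mem_insert_self _ _, Finset.mem_union_right _ (hCB ▸ hx)⟩
    · exact ⟨C, Finset.mem_insert_of_mem (Finset.mem_erase.2 ⟨hCB, Finset.mem_erase.2 ⟨hCA, hC⟩⟩),
        hx⟩

theorem MergeLoop.le_threshold (hsymm : ∀ x y, ρ x y = ρ y x) (h : MergeLoop ρ ε θ Q E Q') :
    ∀ u v, s(u, v) ∈ E → (ρ u v : WithTop ℝ) ≤ θ := by
  induction h with
  | single Q hQ => simp
  | halt => simp
  | merge Q A B u v E Q' hA hB hAB hu hv near short rest ih =>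
    intro x y hxy
    rcases Finset.mem_insert.1 hxy with hxy | hxy
    · rcases Sym2.eq_iff.1 hxy with ⟨rfl, rfl⟩ | ⟨rfl, rfl⟩
      · exact short
      · rwa [hsymm]
    · exact ih x y hxy

theorem MergeLoop.linked {r : Setoid V} (h : MergeLoop ρ ε θ Q E Q') (hQ : Linked r Q)
    (hE : ∀ u v, s(u, v) ∈ E → r u v) : Linked r Q' := by
  induction h with
  | single Q _ => exact hQ
  | halt => exact hQ
  | merge Q A B u v E Q' hA hB hAB hu hv near short rest ih =>
    exact ih (hQ.merge hA hB hu hv (hE u v (Finset.mem_insert_self _ _)))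
      fun x y hxy => hE x y (Finset.mem_insert_of_mem hxy)

theorem MergeLoop.exists_mem (h : MergeLoop ρ ε θ Q E Q') {x : V} (hx : ∃ A ∈ Q, x ∈ A) :
    ∃ A ∈ Q', x ∈ A := by
  induction h with
  | single Q _ => exact hx
  | halt => exact hx
  | merge Q A B u v E Q' hA hB hAB hu hv near short rest ih =>
    obtain ⟨C, hC, hxC⟩ := hx
    exact ih (exists_mem_merge hC hxC)

/-- Different final components are far apart. -/
theorem MergeLoop.lt_of_ne (h : MergeLoop ρ ε θ Q E Q') {A B : Finset V} (hA : A ∈ Q')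
    (hB : B ∈ Q') (hAB : A ≠ B) {u v : V} (hu : u ∈ A) (hv : v ∈ B) :
    θ < (((1 + ε) * ρ u v : ℝ) : WithTop ℝ) := by
  induction h with
  | single Q hQ => exact absurd (Finset.card_le_one.1 hQ A hA B hB) hAB
  | halt Q _ _ _ _ _ _ _ _ _ near long =>
    exact long.trans_le (WithTop.coe_le_coe.2 (near A hA B hB hAB u hu v hv))
  | merge Q A B u v E Q' _ _ _ _ _ near short rest ih => exact ih hA hB

/-- A pair of input points that is short compared with the threshold gets connected by output
edges of at most that length. -/
theorem MergeLoop.rel_of_le {r : Setoid V} {M : ℝ} (h : MergeLoop ρ ε θ Q E Q')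
    (hQ : Linked r Q) (hE : ∀ u v, s(u, v) ∈ E → ρ u v ≤ M → r u v) (hM : (M : WithTop ℝ) ≤ θ)
    {x y : V} (hx : ∃ A ∈ Q, x ∈ A) (hy : ∃ A ∈ Q, y ∈ A) (hxy : (1 + ε) * ρ x y ≤ M) :
    r x y := by
  induction h with
  | single Q hQ1 =>
    obtain ⟨A, hA, hxA⟩ := hx
    obtain ⟨B, hB, hyB⟩ := hy
    obtain rfl := Finset.card_le_one.1 hQ1 A hA B hB
    exact hQ A hA x hxA y hyB
  | halt Q A' B' u v hA' hB' hAB' hu hv near long =>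
    obtain ⟨A, hA, hxA⟩ := hx
    obtain ⟨B, hB, hyB⟩ := hy
    by_cases hAB : A = B
    · subst hAB
      exact hQ A hA x hxA y hyB
    -- `x` and `y` are themselves a competing pair, so the selected edge has length at most `M ≤ θ`
    -- and stopping here is impossible.
    · have h1 := (near A hA B hB hAB x hxA y hyB).trans hxy
      exact absurd ((WithTop.coe_le_coe.2 h1).trans hM) (not_le.2 long)
  | merge Q A' B' u v E Q' hA' hB' hAB' hu hv near short rest ih =>
    obtain ⟨A, hA, hxA⟩ := hx
    obtain ⟨B, hB, hyB⟩ := hy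
    by_cases hAB : A = B
    · subst hAB
      exact hQ A hA x hxA y hyB
    -- While `x` and `y` are apart, the merged edge has length at most `M`. Longer edges may follow,
    -- but only after the two are linked, so `hE` is never needed for them.
    · have h1 := (near A hA B hB hAB x hxA y hyB).trans hxy
      exact ih (hQ.merge hA' hB' hu hv (hE u v (Finset.mem_insert_self _ _) h1))
        (fun a b hab => hE a b (Finset.mem_insert_of_mem hab))
        (exists_mem_merge hA hxA) (exists_mem_merge hB hyB)

/-- The loop can always be executed on nonempty components. -/
theorem exists_mergeLoop [Fintype V] (hε : 0 ≤ ε) (hρ : ∀ x y, 0 ≤ ρ x y) (θ : WithTop ℝ)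
    (Q : Finset (Finset V)) (hQ : ∅ ∉ Q) : ∃ E Q', MergeLoop ρ ε θ Q E Q' := by
  induction hn : Q.card using Nat.strong_induction_on generalizing Q with
  | _ n ih
  by_cases h1 : Q.card ≤ 1
  · exact ⟨∅, Q, .single Q h1⟩
  obtain ⟨A₀, hA₀, B₀, hB₀, hAB₀⟩ := Finset.one_lt_card.1 (not_le.1 h1)
  have hne : ∀ A ∈ Q, A.Nonempty := fun A hA =>
    Finset.nonempty_iff_ne_empty.2 fun h => hQ (h ▸ hA)
  obtain ⟨u₀, hu₀⟩ := hne A₀ hA₀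
  obtain ⟨v₀, hv₀⟩ := hne B₀ hB₀
  -- An exact closest pair across components is always an admissible choice.
  let S : Finset (V × V) := Finset.univ.filter
    fun q => ∃ A ∈ Q, ∃ B ∈ Q, A ≠ B ∧ q.1 ∈ A ∧ q.2 ∈ B
  have hS : S.Nonempty := ⟨(u₀, v₀), by
    simp only [S, Finset.mem_filter, Finset.mem_univ, true_and]
    exact ⟨A₀, hA₀, B₀, hB₀, hAB₀, hu₀, hv₀⟩⟩
  obtain ⟨⟨u, v⟩, huv, hmin⟩ := S.exists_min_image (fun q => ρ q.1 q.2) hS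
  simp only [S, Finset.mem_filter, Finset.mem_univ, true_and] at huv hmin
  obtain ⟨A, hA, B, hB, hAB, hu, hv⟩ := huv
  have near : ∀ A' ∈ Q, ∀ B' ∈ Q, A' ≠ B' → ∀ u' ∈ A', ∀ v' ∈ B',
      ρ u v ≤ (1 + ε) * ρ u' v' := by
    intro A' hA' B' hB' hAB' u' hu' v' hv'
    have h2 := hmin (u', v') ⟨A', hA', B', hB', hAB', hu', hv'⟩
    have h3 := mul_nonneg hε (hρ u' v')
    simp only at h2
    linarith
  by_cases hθ : (ρ u v : WithTop ℝ) ≤ θ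
  · have hcard : (insert (A ∪ B) ((Q.erase A).erase B)).card < n := by
      refine (Finset.card_insert_le _ _).trans_lt ?_
      rw [Finset.card_erase_of_mem (Finset.mem_erase.2 ⟨hAB.symm, hB⟩),
        Finset.card_erase_of_mem hA]
      omega
    have hempty : ∅ ∉ insert (A ∪ B) ((Q.erase A).erase B) := by
      intro h
      rcases Finset.mem_insert.1 h with h | h
      · have : u ∈ A ∪ B := Finset.mem_union_left _ hu
        simp [← h] at this
      · exact hQ (Finset.mem_of_mem_erase (Finset.mem_of_mem_erase h))
    obtain ⟨E, Q', h⟩ := ih _ hcard _ hempty rfl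
    exact ⟨_, Q', .merge Q A B u v E Q' hA hB hAB hu hv near hθ h⟩
  · exact ⟨∅, Q, .halt Q A B u v hA hB hAB hu hv near (not_le.1 hθ)⟩

/-- The points of `C` are represented by input points in `W` within distance `δ`, related to them
by `r`, and the components `Q` cover `W` and are linked by `r`. -/
structure Represents (ρ : V → V → ℝ) (r : Setoid V) (δ : ℝ) (C W : Finset V)
    (Q : Finset (Finset V)) : Prop where
  exists_comp : ∀ u ∈ W, ∃ A ∈ Q, u ∈ A
  linked : Linked r Q
  exists_rep : ∀ x ∈ C, ∃ u ∈ W, ρ x u ≤ δ ∧ r x u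

/-- Thinning the net does not disconnect a point from its representative: the old and the new one
are at most `δ + δ'` apart, while distinct final components are more than `θ / (1 + ε)` apart, so
both lie in one component. -/
theorem UnitStep.represents {r : Setoid V} {δ δ' : ℝ} {C W W' : Finset V} {θ : ℝ}
    (hsymm : ∀ x y, ρ x y = ρ y x) (htri : ∀ x y z, ρ x z ≤ ρ x y + ρ y z) (hε : 0 ≤ ε)
    (h : UnitStep ρ ε θ δ' C W Q E W' Q') (hin : Represents ρ r δ C W Q)
    (hθ : (1 + ε) * (δ + δ') ≤ θ) (hE : ∀ u v, s(u, v) ∈ E → r u v) :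
    Represents ρ r δ' C W' Q' := by
  obtain ⟨R, hR, hWW', hcov, rfl⟩ := h
  have hlink := hR.linked hin.linked hE
  refine ⟨fun u hu => ?_, fun A hA u hu v hv => ?_, fun x hx => ?_⟩
  · obtain ⟨A, hA, huA⟩ := hR.exists_mem (hin.exists_comp u (hWW' hu))
    have hmem : u ∈ A ∩ W' := Finset.mem_inter.2 ⟨huA, hu⟩
    exact ⟨A ∩ W', Finset.mem_erase.2 ⟨Finset.ne_empty_of_mem hmem,
      Finset.mem_image_of_mem _ hA⟩, hmem⟩
  · obtain ⟨A', hA', rfl⟩ := Finset.mem_image.1 (Finset.mem_of_mem_erase hA)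
    exact hlink A' hA' u (Finset.mem_of_mem_inter_left hu) v (Finset.mem_of_mem_inter_left hv)
  · obtain ⟨u, hu, hxu, hru⟩ := hin.exists_rep x hx
    obtain ⟨v, hv, hxv⟩ := hcov x hx
    refine ⟨v, hv, hxv, r.trans hru ?_⟩
    obtain ⟨A, hA, huA⟩ := hR.exists_mem (hin.exists_comp u hu)
    obtain ⟨B, hB, hvB⟩ := hR.exists_mem (hin.exists_comp v (hWW' hv))
    by_cases hAB : A = B
    · subst hAB
      exact hlink A hA u huA v hvB
    · have h1 := WithTop.coe_lt_coe.1 (hR.lt_of_ne hA hB hAB huA hvB)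
      have h2 : ρ u v ≤ δ + δ' := by
        have := htri u x v
        rw [hsymm u x] at this
        linarith
      have h3 := mul_le_mul_of_nonneg_left h2 (show 0 ≤ 1 + ε by linarith)
      linarith

/-- Passing to representatives lengthens the pair by at most `2 * δ`; the loop then links the
representatives with edges of length at most `M`. -/
theorem UnitStep.rel_of_le {r : Setoid V} {δ δ' M : ℝ} {C W W' : Finset V}
    (hsymm : ∀ x y, ρ x y = ρ y x) (htri : ∀ x y z, ρ x z ≤ ρ x y + ρ y z) (hε : 0 ≤ ε)
    (h : UnitStep ρ ε θ δ' C W Q E W' Q') (hin : Represents ρ r δ C W Q)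
    (hE : ∀ u v, s(u, v) ∈ E → ρ u v ≤ M → r u v) (hM : (M : WithTop ℝ) ≤ θ)
    {x y : V} (hx : x ∈ C) (hy : y ∈ C) (hxy : (1 + ε) * (ρ x y + 2 * δ) ≤ M) : r x y := by
  obtain ⟨R, hR, -⟩ := h
  obtain ⟨u, hu, hxu, hru⟩ := hin.exists_rep x hx
  obtain ⟨v, hv, hyv, hrv⟩ := hin.exists_rep y hy
  have h2 : ρ u v ≤ ρ x y + 2 * δ := by
    have h3 := htri u x v
    have h4 := htri x y v
    rw [hsymm u x] at h3
    linarith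
  have h3 := mul_le_mul_of_nonneg_left h2 (show 0 ≤ 1 + ε by linarith)
  exact r.trans hru (r.trans (hR.rel_of_le hin.linked hE hM (hin.exists_comp u hu)
    (hin.exists_comp v hv) (h3.trans hxy)) (r.symm hrv))

end Loop

/-! ### Executions over all levels: connectivity and existence -/

section Execution

variable {V : Type} [Fintype V] [DecidableEq V] {L : ℕ}

theorem HierPartition.exists_child (P : HierPartition V L) (j : Fin L) {C : Finset V}
    (hC : C ∈ (P.level j.succ).parts) {x : V} (hx : x ∈ C) :
    ∃ C' ∈ P.children j C, x ∈ C' := by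
  have hpart := (P.level j.castSucc).part_mem.2 (Finset.mem_univ x)
  have hxp := (P.level j.castSucc).mem_part (Finset.mem_univ x)
  obtain ⟨B, hB, hle⟩ := P.subdivides j hpart
  have hBC : B = C := by
    rw [← (P.level j.succ).part_eq_of_mem hB (hle hxp), (P.level j.succ).part_eq_of_mem hC hx]
  exact ⟨_, Finset.mem_filter.2 ⟨hpart, hBC ▸ hle⟩, hxp⟩

theorem HierPartition.mem_parts_of_mem_children {P : HierPartition V L} {j : Fin L}
    {C C' : Finset V} (h : C' ∈ P.children j C) : C' ∈ (P.level j.castSucc).parts :=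
  (Finset.mem_filter.1 h).1

theorem threshold_castSucc (ε : ℝ) (Δ : Fin (L + 1) → ℝ) (j : Fin L) :
    threshold ε Δ j.castSucc = ((ε * Δ j.castSucc : ℝ) : WithTop ℝ) :=
  if_neg (Fin.castSucc_lt_last j).ne

/-- The covering radius of the input of the unit steps of each level. -/
noncomputable def inputRadius (ε : ℝ) (Δ : Fin (L + 1) → ℝ) (ℓ : Fin (L + 1)) : ℝ :=
  Fin.cases 0 (fun j => ε ^ 2 * Δ j.castSucc) ℓ

theorem inputRadius_le {ε : ℝ} {Δ : Fin (L + 1) → ℝ} (hΔ : Monotone Δ) (h0 : ∀ ℓ, 0 ≤ Δ ℓ)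
    (ℓ : Fin (L + 1)) : inputRadius ε Δ ℓ ≤ ε ^ 2 * Δ ℓ := by
  cases ℓ using Fin.cases with
  | zero => exact mul_nonneg (sq_nonneg ε) (h0 0)
  | succ j => exact mul_le_mul_of_nonneg_left (hΔ (Fin.castSucc_le_succ j)) (sq_nonneg ε)

variable {ρ : V → V → ℝ} {ε : ℝ} {Δ : Fin (L + 1) → ℝ} {P : HierPartition V L}

/-- Induction on the level. Input and output radii are both at most `ε² Δ_ℓ`, so
`UnitStep.represents` needs `(1 + ε) * 2 ε² Δ_ℓ ≤ ε Δ_ℓ`, which follows from `hε2`. -/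
theorem Execution.represents_input (R : Execution ρ ε Δ P) (hself : ∀ x, ρ x x = 0)
    (hsymm : ∀ x y, ρ x y = ρ y x) (htri : ∀ x y z, ρ x z ≤ ρ x y + ρ y z) (hε : 0 ≤ ε)
    (hε2 : (1 + ε) * (2 * ε) ≤ 1) (hΔ : Monotone Δ) (h0 : ∀ ℓ, 0 ≤ Δ ℓ) {r : Setoid V}
    (ℓ : Fin (L + 1))
    (hE : ∀ ℓ' < ℓ, ∀ C ∈ (P.level ℓ').parts, ∀ u v, s(u, v) ∈ R.edges ℓ' C → r u v) :
    ∀ C ∈ (P.level ℓ).parts,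
      Represents ρ r (inputRadius ε Δ ℓ) C (inputPoints P R.net ℓ C) (inputComps P R.comps ℓ C) := by
  induction ℓ using Fin.induction with
  | zero =>
    intro C _
    refine ⟨fun u hu => ⟨{u}, Finset.mem_image_of_mem _ hu, Finset.mem_singleton_self u⟩, ?_,
      fun x hx => ⟨x, hx, (hself x).le, r.refl x⟩⟩
    intro A hA u hu v hv
    obtain ⟨x, -, rfl⟩ := Finset.mem_image.1 hA
    rw [Finset.mem_singleton.1 hu, Finset.mem_singleton.1 hv]
  | succ j ih =>
    have hlt : j.castSucc < j.succ := Fin.castSucc_lt_succ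
    have hout : ∀ C ∈ (P.level j.castSucc).parts, Represents ρ r (ε ^ 2 * Δ j.castSucc) C
        (R.net j.castSucc C) (R.comps j.castSucc C) := by
      intro C hC
      have hstep := R.step j.castSucc C hC
      rw [threshold_castSucc] at hstep
      refine hstep.represents hsymm htri hε
        (ih (fun ℓ' hℓ' => hE ℓ' (hℓ'.trans hlt)) C hC) ?_ (hE _ hlt C hC)
      have h1 := inputRadius_le (ε := ε) hΔ h0 j.castSucc
      have h2 : (1 + ε) * (inputRadius ε Δ j.castSucc + ε ^ 2 * Δ j.castSucc) ≤
          (1 + ε) * (2 * (ε ^ 2 * Δ j.castSucc)) :=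
        mul_le_mul_of_nonneg_left (by linarith) (by linarith)
      have h3 := mul_le_mul_of_nonneg_right hε2 (mul_nonneg hε (h0 j.castSucc))
      linarith
    intro C hC
    refine ⟨fun u hu => ?_, fun A hA => ?_, fun x hx => ?_⟩
    · obtain ⟨C', hC', hu⟩ := Finset.mem_biUnion.1 hu
      obtain ⟨A, hA, huA⟩ := (hout C' (P.mem_parts_of_mem_children hC')).exists_comp u hu
      exact ⟨A, Finset.mem_biUnion.2 ⟨C', hC', hA⟩, huA⟩
    · obtain ⟨C', hC', hA⟩ := Finset.mem_biUnion.1 hA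
      exact (hout C' (P.mem_parts_of_mem_children hC')).linked A hA
    · obtain ⟨C', hC', hx⟩ := P.exists_child j hC hx
      obtain ⟨u, hu, h⟩ := (hout C' (P.mem_parts_of_mem_children hC')).exists_rep x hx
      exact ⟨u, Finset.mem_biUnion.2 ⟨C', hC', hu⟩, h⟩

/-- If `x` and `y` are in the same cell at the first level whose threshold is at least `M`, then
they are connected by output edges of length at most `M`. -/
theorem Execution.rel_of_part_eq (R : Execution ρ ε Δ P) (hself : ∀ x, ρ x x = 0)
    (hsymm : ∀ x y, ρ x y = ρ y x) (htri : ∀ x y z, ρ x z ≤ ρ x y + ρ y z) (hε : 0 ≤ ε)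
    (hε2 : (1 + ε) * (2 * ε) ≤ 1) (hΔ : Monotone Δ) (h0 : ∀ ℓ, 0 ≤ Δ ℓ) {r : Setoid V} {M : ℝ}
    (hM : 0 ≤ M) {ℓ : Fin (L + 1)} (hℓ : (M : WithTop ℝ) ≤ threshold ε Δ ℓ)
    (hlow : ∀ ℓ' < ℓ, ε * Δ ℓ' ≤ M)
    (hE : ∀ ℓ', ∀ C ∈ (P.level ℓ').parts, ∀ u v, s(u, v) ∈ R.edges ℓ' C → ρ u v ≤ M → r u v)
    {x y : V} (hxy : (P.level ℓ).part x = (P.level ℓ).part y)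
    (hρ : (1 + ε) * (ρ x y + 2 * (ε * M)) ≤ M) : r x y := by
  have hC := (P.level ℓ).part_mem.2 (Finset.mem_univ x)
  have hx := (P.level ℓ).mem_part (Finset.mem_univ x)
  have hy := (P.level ℓ).mem_part (Finset.mem_univ y)
  rw [← hxy] at hy
  -- Edges of levels below `ℓ` respect thresholds that are at most `M`, so `r` contains all of them.
  have hin := R.represents_input hself hsymm htri hε hε2 hΔ h0 (r := r) ℓ (by
    intro ℓ' hℓ' C hC u v huv
    obtain ⟨S, hS, -⟩ := R.step ℓ' C hC
    have h1 := hS.le_threshold hsymm u v huv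
    have hne : ℓ' ≠ Fin.last L := (hℓ'.trans_le (Fin.le_last ℓ)).ne
    rw [threshold, if_neg hne, WithTop.coe_le_coe] at h1
    exact hE ℓ' C hC u v huv (h1.trans (hlow ℓ' hℓ'))) _ hC
  refine (R.step ℓ _ hC).rel_of_le hsymm htri hε hin (hE ℓ _ hC) hℓ hx hy (le_trans ?_ hρ)
  -- One factor `ε` of `ε² Δ_{ℓ-1}` is absorbed by `ε Δ_{ℓ-1} ≤ M`, so the rounding error is
  -- relative to the pair and not to the scale `Δ_ℓ`.
  have hrad : inputRadius ε Δ ℓ ≤ ε * M := by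
    cases ℓ using Fin.cases with
    | zero => exact mul_nonneg hε hM
    | succ j =>
      have h1 := mul_le_mul_of_nonneg_left (hlow j.castSucc Fin.castSucc_lt_succ) hε
      have h2 : inputRadius ε Δ j.succ = ε * (ε * Δ j.castSucc) := by
        simp only [inputRadius, Fin.cases_succ]
        ring
      rwa [h2]
  exact mul_le_mul_of_nonneg_left (by linarith) (by linarith)

theorem exists_first_level (ε : ℝ) (Δ : Fin (L + 1) → ℝ) (M : ℝ) :
    ∃ ℓ, (M : WithTop ℝ) ≤ threshold ε Δ ℓ ∧ ∀ ℓ' < ℓ, ε * Δ ℓ' ≤ M := by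
  obtain ⟨ℓ, hℓ, hmin⟩ := WellFounded.has_min (wellFounded_lt (α := Fin (L + 1)))
    {ℓ | (M : WithTop ℝ) ≤ threshold ε Δ ℓ} ⟨Fin.last L, by simp [threshold]⟩
  refine ⟨ℓ, hℓ, fun ℓ' hlt => ?_⟩
  have h1 := not_le.1 fun h : (M : WithTop ℝ) ≤ threshold ε Δ ℓ' => hmin ℓ' h hlt
  rw [threshold, if_neg (hlt.trans_le (Fin.le_last ℓ)).ne, WithTop.coe_lt_coe] at h1
  exact h1.le

/-- Dependent choice along the levels: the unit steps of a level need only the outputs of the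
previous one, and `good` carries what makes the next level executable. -/
theorem exists_fin_chain {S : Type} {L : ℕ} (good : Fin (L + 1) → S → Prop)
    (step : Fin L → S → S → Prop) (init : S) (hinit : good 0 init)
    (hstep : ∀ j s, good j.castSucc s → ∃ s', good j.succ s' ∧ step j s s') :
    ∃ f : Fin (L + 1) → S, f 0 = init ∧ ∀ j, step j (f j.castSucc) (f j.succ) := by
  choose next hgood hnext using hstep
  let f : ∀ ℓ : Fin (L + 1), {s // good ℓ s} := fun ℓ =>
    Fin.induction (motive := fun ℓ => {s // good ℓ s}) ⟨init, hinit⟩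
      (fun j s => ⟨next j s.1 s.2, hgood j s.1 s.2⟩) ℓ
  refine ⟨fun ℓ => (f ℓ).1, rfl, fun j => ?_⟩
  have : (f j.succ).1 = next j (f j.castSucc).1 (f j.castSucc).2 := by
    simp only [f, Fin.induction_succ]
  simp only [this]
  exact hnext j _ _

/-- The unit step can be executed in all cells of a level at once. -/
theorem exists_unitSteps (hρ : ∀ x y, 0 ≤ ρ x y) (hε : 0 ≤ ε) (θ : WithTop ℝ) (δ : ℝ)
    (cells : Finset (Finset V)) (W : Finset V → Finset V) (Q : Finset V → Finset (Finset V))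
    (hW : ∀ C ∈ cells, ∀ x ∈ C, ∃ y ∈ W C, ρ x y ≤ δ) (hQ : ∀ C ∈ cells, ∅ ∉ Q C) :
    ∃ s : (Finset V → Finset (Sym2 V)) × (Finset V → Finset (Finset V)),
      ∀ C ∈ cells, ∅ ∉ s.2 C ∧ UnitStep ρ ε θ δ C (W C) (Q C) (s.1 C) (W C) (s.2 C) := by
  choose E R hR using fun C : cells => exists_mergeLoop hε hρ θ (Q C) (hQ C C.2)
  refine ⟨⟨fun C => if h : C ∈ cells then E ⟨C, h⟩ else ∅, fun C =>
    if h : C ∈ cells then ((R ⟨C, h⟩).image (fun A => A ∩ W C)).erase ∅ else ∅⟩, fun C hC => ?_⟩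
  simp only [dif_pos hC]
  exact ⟨Finset.notMem_erase _ _, R ⟨C, hC⟩, hR ⟨C, hC⟩, Finset.Subset.refl _, hW C hC, rfl⟩

/-- The execution built here never thins its nets. The invariant is that the net covers the cell and
no component is empty; the covering passes upwards because `Δ` is monotone. -/
theorem nonempty_execution (hself : ∀ x, ρ x x = 0) (hρ : ∀ x y, 0 ≤ ρ x y) (hε : 0 ≤ ε)
    (hΔ : Monotone Δ) (h0 : ∀ ℓ, 0 ≤ Δ ℓ) (P : HierPartition V L) :
    Nonempty (Execution ρ ε Δ P) := by
  let S : Type := (Finset V → Finset (Sym2 V)) × (Finset V → Finset V) ×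
    (Finset V → Finset (Finset V))
  let stepAt : ∀ ℓ : Fin (L + 1), (Finset V → Finset V) → (Finset V → Finset (Finset V)) → S →
      Prop := fun ℓ W Q s => ∀ C ∈ (P.level ℓ).parts,
    UnitStep ρ ε (threshold ε Δ ℓ) (ε ^ 2 * Δ ℓ) C (W C) (Q C) (s.1 C) (s.2.1 C) (s.2.2 C)
  let good : Fin (L + 1) → S → Prop := fun ℓ s => ∀ C ∈ (P.level ℓ).parts,
    (∀ x ∈ C, ∃ y ∈ s.2.1 C, ρ x y ≤ ε ^ 2 * Δ ℓ) ∧ ∅ ∉ s.2.2 C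
  have hex : ∀ ℓ (W : Finset V → Finset V) (Q : Finset V → Finset (Finset V)),
      (∀ C ∈ (P.level ℓ).parts, (∀ x ∈ C, ∃ y ∈ W C, ρ x y ≤ ε ^ 2 * Δ ℓ) ∧ ∅ ∉ Q C) →
      ∃ s, good ℓ s ∧ stepAt ℓ W Q s := by
    intro ℓ W Q h
    obtain ⟨s, hs⟩ := exists_unitSteps hρ hε (threshold ε Δ ℓ) (ε ^ 2 * Δ ℓ) (P.level ℓ).parts W Q
      (fun C hC => (h C hC).1) (fun C hC => (h C hC).2)
    exact ⟨(s.1, W, s.2), fun C hC => ⟨(h C hC).1, (hs C hC).1⟩, fun C hC => (hs C hC).2⟩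
  obtain ⟨init, hinit, hinit'⟩ := hex 0 (fun C => C) (fun C => C.image fun x => {x}) (by
    intro C _
    refine ⟨fun x hx => ⟨x, hx, (hself x).trans_le (mul_nonneg (sq_nonneg ε) (h0 0))⟩, ?_⟩
    intro h
    obtain ⟨x, -, hx⟩ := Finset.mem_image.1 h
    exact Finset.singleton_ne_empty x hx)
  obtain ⟨f, hf0, hf⟩ := exists_fin_chain good
    (fun j s s' => stepAt j.succ (fun C => (P.children j C).biUnion s.2.1)
      (fun C => (P.children j C).biUnion s.2.2) s') init hinit (by
    intro j s hs
    refine hex j.succ _ _ fun C hC => ⟨fun x hx => ?_, fun h => ?_⟩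
    · obtain ⟨C', hC', hx⟩ := P.exists_child j hC hx
      obtain ⟨y, hy, hxy⟩ := (hs C' (P.mem_parts_of_mem_children hC')).1 x hx
      exact ⟨y, Finset.mem_biUnion.2 ⟨C', hC', hy⟩, hxy.trans
        (mul_le_mul_of_nonneg_left (hΔ (Fin.castSucc_le_succ j)) (sq_nonneg ε))⟩
    · obtain ⟨C', hC', h⟩ := Finset.mem_biUnion.1 h
      exact (hs C' (P.mem_parts_of_mem_children hC')).2 h)
  refine ⟨⟨fun ℓ => (f ℓ).1, fun ℓ => (f ℓ).2.1, fun ℓ => (f ℓ).2.2, fun ℓ => ?_⟩⟩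
  cases ℓ using Fin.cases with
  | zero =>
    rw [hf0]
    exact hinit'
  | succ j => exact hf j

end Execution

/-! ### From shared cells to success of the algorithm -/

section Points

variable {p : ℝ≥0∞} [Fact (1 ≤ p)] {d n L : ℕ}

theorem diam_nonneg {V : Type} {ρ : V → V → ℝ} (hρ : ∀ x y, 0 ≤ ρ x y) (C : Finset V) :
    0 ≤ diam ρ C :=
  Real.iSup_nonneg fun _ => hρ _ _

theorem scale_nonneg {V : Type} [Fintype V] {ρ : V → V → ℝ} (hρ : ∀ x y, 0 ≤ ρ x y) {a γ : ℝ}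
    (ha : 0 ≤ a) (hγ : 0 ≤ γ) (ℓ : Fin (L + 1)) : 0 ≤ scale ρ a γ L ℓ :=
  mul_nonneg (mul_nonneg hγ (pow_nonneg ha _)) (diam_nonneg hρ _)

theorem scale_monotone {V : Type} [Fintype V] {ρ : V → V → ℝ} (hρ : ∀ x y, 0 ≤ ρ x y) {a γ : ℝ}
    (ha : 0 ≤ a) (ha1 : a ≤ 1) (hγ : 0 ≤ γ) : Monotone (scale ρ a γ L) := by
  intro ℓ ℓ' h
  refine mul_le_mul_of_nonneg_right (mul_le_mul_of_nonneg_left ?_ hγ) (diam_nonneg hρ _)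
  exact pow_le_pow_of_le_one ha ha1 (Nat.sub_le_sub_left h L)

/-- The algorithm succeeds if each pair of points shares, in some sample, the cell of a level
whose threshold exceeds, as the first one, `1 + η` times their distance. -/
theorem succeeds_of_part_eq [NeZero n] (v : Fin n → PiLp p (fun _ : Fin d => ℝ)) {ε η : ℝ}
    {Δ : Fin (L + 1) → ℝ} (hε : 0 ≤ ε) (hε2 : (1 + ε) * (2 * ε) ≤ 1) (hη : 0 ≤ η)
    (hεη : (1 + ε) * (1 + 2 * (ε * (1 + η))) ≤ 1 + η) (hΔ : Monotone Δ) (h0 : ∀ ℓ, 0 ≤ Δ ℓ)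
    {k : ℕ} {P : Fin k → HierPartition (Fin n) L}
    (h : ∀ x y, ∃ i, ∃ ℓ, (((1 + η) * pointDist v x y : ℝ) : WithTop ℝ) ≤ threshold ε Δ ℓ ∧
      (∀ ℓ' < ℓ, ε * Δ ℓ' ≤ (1 + η) * pointDist v x y) ∧
      ((P i).level ℓ).part x = ((P i).level ℓ).part y) :
    Succeeds v ε Δ η P := by
  have hself : ∀ x, pointDist v x x = 0 := fun x => dist_self _
  have hnn : ∀ x y, 0 ≤ pointDist v x y := fun x y => dist_nonneg
  refine ⟨fun i => nonempty_execution hself hnn hε hΔ h0 _, fun R => ?_⟩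
  have hreach : ∀ x y, (sublevel (pointWeight v) (unionGraph R)
      ((1 + η) * pointWeight v s(x, y))).Reachable x y := by
    intro x y
    obtain ⟨i, ℓ, hℓ, hlow, hpart⟩ := h x y
    have hw : ∀ x y, pointWeight v s(x, y) = pointDist v x y := fun x y => rfl
    rw [hw]
    refine (R i).rel_of_part_eq (r := SimpleGraph.reachableSetoid _) hself
      (fun x y => dist_comm _ _) (fun x y z => dist_triangle _ _ _) hε hε2 hΔ h0
      (mul_nonneg (by linarith) (hnn x y)) hℓ hlow ?_ hpart ?_
    · intro ℓ' C hC a b hab hM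
      -- `fromEdgeSet` drops loops, so a degenerate output pair is covered by reflexivity.
      by_cases hne : a = b
      · rw [hne]
      · refine SimpleGraph.Adj.reachable (sublevel_adj.2 ⟨?_, hM⟩)
        rw [unionGraph, SimpleGraph.fromEdgeSet_adj]
        exact ⟨Set.mem_iUnion.2 ⟨i, ℓ', C, hC, hab⟩, hne⟩
    · have := mul_le_mul_of_nonneg_right hεη (hnn x y)
      linarith
  refine ⟨⟨fun x y => (hreach x y).mono (sublevel_le _ _ _)⟩, fun T hT T₀ hT₀ => ?_⟩
  exact hT.forall₂_sortedWeights (by linarith) hT₀.2.1 hreach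

end Points

/-! ### Cut probability and union bound -/

section Probability

variable {p : ℝ≥0∞} [Fact (1 ≤ p)] {d n L : ℕ}

theorem HierPartition.part_last {V : Type} [Fintype V] [DecidableEq V] (P : HierPartition V L)
    (x : V) : (P.level (Fin.last L)).part x = Finset.univ := by
  have h := (P.level (Fin.last L)).part_mem.2 (Finset.mem_univ x)
  rwa [P.root, Finset.mem_singleton] at h

/-- At the root nothing is cut. Below it, `ρ x y ≤ M ≤ ε Δ_ℓ` bounds the quotient in `cut_prob` by
`ε`, also when `Δ_ℓ = 0`, where the quotient is zero. -/
theorem IsDistancePreserving.cut_prob_le {V : Type} [Fintype V] [DecidableEq V] {ρ : V → V → ℝ}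
    {D : MeasureTheory.Measure (HierPartition V L)} {a b c γ : ℝ}
    (hD : IsDistancePreserving ρ D a b c γ) (hρ : ∀ x y, 0 ≤ ρ x y) {ε M : ℝ} (hε : 0 ≤ ε)
    {x y : V} {ℓ : Fin (L + 1)} (hxy : ρ x y ≤ M)
    (hM : (M : WithTop ℝ) ≤ threshold ε (scale ρ a γ L) ℓ) :
    D.real {P | (P.level ℓ).part x ≠ (P.level ℓ).part y} ≤ b * ε := by
  by_cases hℓ : ℓ = Fin.last L
  · subst hℓ
    simp only [HierPartition.part_last, ne_eq, not_true_eq_false, Set.ofPred_false,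
      MeasureTheory.measureReal_empty]
    exact mul_nonneg hD.b_pos.le hε
  · rw [threshold, if_neg hℓ, WithTop.coe_le_coe] at hM
    refine (hD.cut_prob x y ℓ).trans (mul_le_mul_of_nonneg_left ?_ hD.b_pos.le)
    exact div_le_of_le_mul₀ (scale_nonneg hρ hD.a_pos.le (by linarith [hD.one_le_γ]) ℓ) hε
      (hxy.trans hM)

theorem sq_mul_half_pow_le {n k : ℕ} (hn : 1 ≤ n) {κ : ℝ}
    (hk : (κ + 2) / Real.log 2 * Real.log n ≤ k) :
    (n : ℝ) ^ 2 * (1 / 2) ^ k ≤ (n : ℝ) ^ (-κ) := by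
  have hn0 : (0 : ℝ) < n := by exact_mod_cast hn
  have hlog : 0 < Real.log 2 := Real.log_pos (by norm_num)
  have h1 : ((1 : ℝ) / 2) ^ k ≤ (n : ℝ) ^ (-(κ + 2)) := by
    rw [Real.rpow_def_of_pos hn0, one_div, inv_pow, ← Real.exp_log (show (0 : ℝ) < 2 ^ k by
      positivity), ← Real.exp_neg, Real.exp_le_exp, Real.log_pow]
    rw [div_mul_eq_mul_div, div_le_iff₀ hlog] at hk
    linarith
  calc (n : ℝ) ^ 2 * (1 / 2) ^ k ≤ (n : ℝ) ^ 2 * (n : ℝ) ^ (-(κ + 2)) :=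
        mul_le_mul_of_nonneg_left h1 (by positivity)
    _ = (n : ℝ) ^ (-κ) := by
        rw [← Real.rpow_natCast, ← Real.rpow_add hn0]
        congr 1
        push_cast
        ring

theorem IsDistancePreserving.prob_succeeds_ge (hn : 1 ≤ n)
    (v : Fin n → PiLp p (fun _ : Fin d => ℝ)) {a b c γ ε η : ℝ}
    {D : MeasureTheory.Measure (HierPartition (Fin n) L)}
    (hD : IsDistancePreserving (pointDist v) D a b c γ) (hε : 0 ≤ ε)
    (hε2 : (1 + ε) * (2 * ε) ≤ 1) (hη : 0 ≤ η)
    (hεη : (1 + ε) * (1 + 2 * (ε * (1 + η))) ≤ 1 + η) (hbε : b * ε ≤ 1 / 2) (k : ℕ) :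
    1 - (n : ℝ) ^ 2 * (1 / 2) ^ k ≤ (MeasureTheory.Measure.pi (fun _ : Fin k => D)).real
      {P | Succeeds v ε (scale (pointDist v) a γ L) η P} := by
  have := hD.prob
  have : NeZero n := ⟨by omega⟩
  have hnn : ∀ x y, 0 ≤ pointDist v x y := fun x y => dist_nonneg
  have hγ : 0 ≤ γ := by linarith [hD.one_le_γ]
  -- One level per pair, fixed before sampling: the union bound runs over pairs only, not over
  -- levels.
  choose ℓ hℓ hlow using fun x y =>
    exists_first_level ε (scale (pointDist v) a γ L) ((1 + η) * pointDist v x y)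
  let cut : Fin n × Fin n → Set (HierPartition (Fin n) L) := fun q =>
    {P | (P.level (ℓ q.1 q.2)).part q.1 ≠ (P.level (ℓ q.1 q.2)).part q.2}
  let bad : Fin n × Fin n → Set (Fin k → HierPartition (Fin n) L) := fun q =>
    Set.univ.pi fun _ => cut q
  set μ := MeasureTheory.Measure.pi (fun _ : Fin k => D)
  set good := {P | Succeeds v ε (scale (pointDist v) a γ L) η P}
  have hbad : ∀ q, μ.real (bad q) ≤ (1 / 2) ^ k := by
    intro q
    -- A pair is bad when every sample cuts it; this event is a box in the product space.
    have h1 : μ.real (bad q) = D.real (cut q) ^ k := by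
      simp only [μ, bad, MeasureTheory.measureReal_def, MeasureTheory.Measure.pi_pi,
        Finset.prod_const, Finset.card_univ, Fintype.card_fin, ENNReal.toReal_pow]
    rw [h1]
    refine pow_le_pow_left₀ MeasureTheory.measureReal_nonneg (le_trans ?_ hbε) k
    refine hD.cut_prob_le hnn hε ?_ (hℓ q.1 q.2)
    nlinarith [hnn q.1 q.2]
  have hsub : goodᶜ ⊆ ⋃ q ∈ (Finset.univ : Finset (Fin n × Fin n)), bad q := by
    intro P hP
    by_contra hnot
    refine hP (succeeds_of_part_eq v hε hε2 hη hεη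
      (scale_monotone hnn hD.a_pos.le hD.a_lt_one.le hγ)
      (scale_nonneg hnn hD.a_pos.le hγ) fun x y => ?_)
    have hq : P ∉ bad (x, y) := fun h => hnot (Set.mem_biUnion (Finset.mem_univ (x, y)) h)
    simp only [bad, cut, Set.mem_univ_pi, Set.mem_ofPred_eq, not_forall, not_not] at hq
    obtain ⟨i, hi⟩ := hq
    exact ⟨i, ℓ x y, hℓ x y, hlow x y, hi⟩
  have hfail : μ.real goodᶜ ≤ (n : ℝ) ^ 2 * (1 / 2) ^ k := by
    calc μ.real goodᶜ ≤ μ.real (⋃ q ∈ (Finset.univ : Finset (Fin n × Fin n)), bad q) :=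
          MeasureTheory.measureReal_mono hsub (MeasureTheory.measure_ne_top μ _)
      _ ≤ ∑ q, μ.real (bad q) := MeasureTheory.measureReal_biUnion_finset_le _ _
      _ ≤ ∑ _q : Fin n × Fin n, (1 / 2) ^ k := Finset.sum_le_sum fun q _ => hbad q
      _ = (n : ℝ) ^ 2 * (1 / 2) ^ k := by
          simp [Finset.card_univ, sq]
  -- Subadditivity suffices here, so measurability of `good` is not required.
  have htot : (1 : ℝ) ≤ μ.real good + μ.real goodᶜ := by
    have := MeasureTheory.measureReal_union_le (μ := μ) good goodᶜ
    rwa [Set.union_compl_self, MeasureTheory.probReal_univ] at this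
  linarith

end Probability

/-! ### Randomly shifted grids on a line -/

section Shift

open MeasureTheory

theorem intervalIntegrable_fract_sub (α c : ℝ) :
    IntervalIntegrable (fun t : ℝ => Int.fract (α - c * t)) volume 0 1 := by
  rw [intervalIntegrable_iff]
  refine Measure.integrableOn_of_bounded (M := 1) (by simp) ?_ ?_
  · exact (measurable_fract.comp (by fun_prop)).aestronglyMeasurable
  · refine Filter.Eventually.of_forall fun t => ?_
    rw [Real.norm_eq_abs, abs_of_nonneg (Int.fract_nonneg _)]
    exact (Int.fract_lt_one _).le

/-- Replacing `t` by `t - α / M` removes `α`, and since `M` is an integer the integrand has period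
1, so the shifted window has the same integral. -/
theorem integral_fract_sub (α : ℝ) {M : ℕ} (hM : M ≠ 0) :
    ∫ t in (0 : ℝ)..1, Int.fract (α - M * t) = ∫ t in (0 : ℝ)..1, Int.fract (-(M * t)) := by
  have hM' : (M : ℝ) ≠ 0 := by exact_mod_cast hM
  have hper : Function.Periodic (fun t : ℝ => Int.fract (-(M * t))) 1 := by
    intro t
    have h : -((M : ℝ) * (t + 1)) = -(M * t) - (M : ℕ) := by ring
    simp only [h, Int.fract_sub_natCast]
  have h1 : ∀ t : ℝ, Int.fract (α - M * t) = (fun t : ℝ => Int.fract (-(M * t))) (t - α / M) := by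
    intro t
    simp only
    congr 1
    field_simp
    ring
  simp_rw [h1]
  rw [intervalIntegral.integral_comp_sub_right (fun t : ℝ => Int.fract (-(M * t)))]
  have h2 := hper.intervalIntegral_add_eq (0 - α / M) 0
  rw [zero_add] at h2
  rw [← h2]
  congr 1
  ring

theorem intervalIntegrable_floor_sub (α c : ℝ) :
    IntervalIntegrable (fun t : ℝ => (⌊α - c * t⌋ : ℝ)) volume 0 1 := by
  have h : (fun t : ℝ => (⌊α - c * t⌋ : ℝ)) = fun t => (α - c * t) - Int.fract (α - c * t) := by
    funext t
    rw [Int.self_sub_fract]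
  rw [h]
  exact (Continuous.intervalIntegrable (by fun_prop) _ _).sub (intervalIntegrable_fract_sub α c)

/-- Write each floor as the number minus its fractional part; the two fractional parts have equal
mean and cancel. -/
theorem integral_floor_sub_floor (α β : ℝ) {M : ℕ} (hM : M ≠ 0) :
    ∫ t in (0 : ℝ)..1, ((⌊β - M * t⌋ : ℝ) - ⌊α - M * t⌋) = β - α := by
  have h : ∀ t : ℝ, ((⌊β - M * t⌋ : ℝ) - ⌊α - M * t⌋) =
      (β - α) - (Int.fract (β - M * t) - Int.fract (α - M * t)) := by
    intro t
    have h1 := Int.self_sub_fract (β - M * t)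
    have h2 := Int.self_sub_fract (α - M * t)
    linarith
  simp_rw [h]
  rw [intervalIntegral.integral_sub (by simp)
    ((intervalIntegrable_fract_sub β M).sub (intervalIntegrable_fract_sub α M)),
    intervalIntegral.integral_sub (intervalIntegrable_fract_sub β M)
      (intervalIntegrable_fract_sub α M), integral_fract_sub β hM, integral_fract_sub α hM]
  simp

theorem measurableSet_floor_ne (α β c : ℝ) :
    MeasurableSet {ω : unitInterval | ⌊α - c * (ω : ℝ)⌋ ≠ ⌊β - c * (ω : ℝ)⌋} := by
  refine (measurableSet_eq_fun ?_ ?_).compl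
  · exact Int.measurable_floor.comp (by fun_prop)
  · exact Int.measurable_floor.comp (by fun_prop)

/-- Two points of a line are separated by a randomly shifted grid with probability at most their
distance in units of the grid width. -/
theorem volume_floor_ne_le (α β : ℝ) {M : ℕ} (hM : M ≠ 0) :
    (volume : Measure unitInterval).real
      {ω | ⌊α - M * (ω : ℝ)⌋ ≠ ⌊β - M * (ω : ℝ)⌋} ≤ |α - β| := by
  wlog hαβ : α ≤ β generalizing α β
  · have := this β α (le_of_not_ge hαβ)
    simp only [ne_comm (a := ⌊β - _⌋)] at this
    rwa [abs_sub_comm]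
  set S : Set unitInterval := {ω | ⌊α - M * (ω : ℝ)⌋ ≠ ⌊β - M * (ω : ℝ)⌋}
  let g : ℝ → ℝ := fun t => (⌊β - M * t⌋ : ℝ) - ⌊α - M * t⌋
  have hg : IntegrableOn g (Set.Icc 0 1) volume := by
    have := (intervalIntegrable_floor_sub β M).sub (intervalIntegrable_floor_sub α M)
    rwa [intervalIntegrable_iff_integrableOn_Icc_of_le zero_le_one] at this
  have hgI : Integrable (fun ω : unitInterval => g ω) volume :=
    unitInterval.measurePreserving_coe.integrable_comp_of_integrable hg
  calc (volume : Measure unitInterval).real S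
      = ∫ ω, S.indicator (fun _ => (1 : ℝ)) ω := by
        rw [integral_indicator (measurableSet_floor_ne α β M)]
        simp [S]
    -- Floors are integers, so for `α ≤ β` different floors differ by at least 1 and `g` dominates
    -- the indicator.
    _ ≤ ∫ ω : unitInterval, g ω := by
        refine integral_mono ((integrable_const _).indicator (measurableSet_floor_ne α β M)) hgI ?_
        intro ω
        have hle : ⌊α - M * (ω : ℝ)⌋ ≤ ⌊β - M * (ω : ℝ)⌋ := Int.floor_le_floor (by linarith)
        by_cases hω : ω ∈ S
        · rw [Set.indicator_of_mem hω]
          have h1 : ⌊α - M * (ω : ℝ)⌋ + 1 ≤ ⌊β - M * (ω : ℝ)⌋ := lt_of_le_of_ne hle hω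
          have h2 : ((⌊α - M * (ω : ℝ)⌋ : ℝ)) + 1 ≤ ⌊β - M * (ω : ℝ)⌋ := by exact_mod_cast h1
          simp only [g]
          linarith
        · rw [Set.indicator_of_notMem hω]
          simp only [g, sub_nonneg]
          exact_mod_cast hle
    _ = ∫ t in Set.Icc (0 : ℝ) 1, g t :=
        unitInterval.measurePreserving_coe.integral_comp unitInterval.measurableEmbedding_coe g
    _ = ∫ t in (0 : ℝ)..1, g t := by
        rw [integral_Icc_eq_integral_Ioc, intervalIntegral.integral_of_le zero_le_one]
    _ = β - α := integral_floor_sub_floor α β hM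
    _ = |α - β| := by rw [abs_sub_comm, abs_of_nonneg (by linarith)]

end Shift

/-! ### Comparison of norms -/

section Norms

variable {d : ℕ}

/-- Comparison of the `ℓ_p` norm with the `ℓ_∞` and `ℓ_1` norms, with the constant `d^(1/p)`. -/
theorem exists_norm_comparison (p : ℝ≥0∞) [Fact (1 ≤ p)] (hp : p = 1 ∨ p = 2 ∨ p = ⊤)
    (hd : 1 ≤ d) : ∃ e : ℝ, 0 ≤ e ∧ e ≤ d ∧
      (∀ x : PiLp p (fun _ : Fin d => ℝ), ‖x‖ ≤ e * ‖WithLp.ofLp x‖) ∧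
      ∀ x : PiLp p (fun _ : Fin d => ℝ), (∑ i, |x i|) * e ≤ d * ‖x‖ := by
  have hd' : (1 : ℝ) ≤ d := by exact_mod_cast hd
  have hcoord : ∀ (x : PiLp p (fun _ : Fin d => ℝ)) i, |x i| ≤ ‖WithLp.ofLp x‖ :=
    fun x i => norm_le_pi_norm (WithLp.ofLp x) i
  rcases hp with rfl | rfl | rfl
  · have hnorm : ∀ x : PiLp 1 (fun _ : Fin d => ℝ), ‖x‖ = ∑ i, |x i| := by
      intro x
      simp [PiLp.norm_eq_of_L1]
    refine ⟨d, by linarith, le_rfl, fun x => ?_, fun x => ?_⟩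
    · rw [hnorm]
      refine (Finset.sum_le_sum fun i _ => hcoord x i).trans ?_
      simp
    · rw [hnorm, mul_comm]
  · have hnorm : ∀ x : PiLp 2 (fun _ : Fin d => ℝ), ‖x‖ = √(∑ i, |x i| ^ 2) := by
      intro x
      simp [PiLp.norm_eq_of_L2]
    have hsq : √(d : ℝ) * √d = d := Real.mul_self_sqrt (by linarith)
    refine ⟨√d, Real.sqrt_nonneg _, ?_, fun x => ?_, fun x => ?_⟩
    · rw [Real.sqrt_le_left (by linarith)]
      nlinarith
    · rw [hnorm, Real.sqrt_le_left (by positivity), mul_pow, Real.sq_sqrt (by linarith)]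
      refine (Finset.sum_le_sum fun i _ =>
        pow_le_pow_left₀ (abs_nonneg _) (hcoord x i) 2).trans ?_
      simp
    · rw [hnorm]
      have h1 : ∑ i, |x i| ≤ √d * √(∑ i, |x i| ^ 2) := by
        rw [← Real.sqrt_mul (by linarith)]
        apply Real.le_sqrt_of_sq_le
        simpa using sq_sum_le_card_mul_sum_sq (s := Finset.univ) (f := fun i => |x i|)
      calc (∑ i, |x i|) * √d ≤ (√d * √(∑ i, |x i| ^ 2)) * √d :=
            mul_le_mul_of_nonneg_right h1 (Real.sqrt_nonneg _)
        _ = d * √(∑ i, |x i| ^ 2) := by rw [mul_right_comm, hsq]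
  · have hnorm : ∀ x : PiLp ⊤ (fun _ : Fin d => ℝ), ‖x‖ = ‖WithLp.ofLp x‖ := fun x =>
      (PiLp.norm_ofLp x).symm
    refine ⟨1, zero_le_one, hd', fun x => ?_, fun x => ?_⟩
    · rw [hnorm, one_mul]
    · rw [hnorm, mul_one]
      refine (Finset.sum_le_sum fun i _ => hcoord x i).trans ?_
      simp

theorem norm_ofLp_le (p : ℝ≥0∞) [Fact (1 ≤ p)] (x : PiLp p (fun _ : Fin d => ℝ)) :
    ‖WithLp.ofLp x‖ ≤ ‖x‖ :=
  (pi_norm_le_iff_of_nonneg (norm_nonneg _)).2 fun i => PiLp.norm_apply_le x i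

end Norms

/-! ### The randomly shifted grid in several dimensions -/

section Grid

open MeasureTheory

variable {p : ℝ≥0∞} {d n m L : ℕ}

theorem le_diam {V : Type} [Fintype V] (ρ : V → V → ℝ) {C : Finset V} {x y : V} (hx : x ∈ C)
    (hy : y ∈ C) : ρ x y ≤ diam ρ C :=
  le_ciSup (f := fun q : C × C => ρ q.1 q.2) (Set.finite_range _).bddAbove (⟨x, hx⟩, ⟨y, hy⟩)

theorem diam_le {V : Type} {ρ : V → V → ℝ} {C : Finset V} {B : ℝ} (hB : 0 ≤ B)
    (h : ∀ x ∈ C, ∀ y ∈ C, ρ x y ≤ B) : diam ρ C ≤ B :=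
  Real.iSup_le (fun q => h _ q.1.2 _ q.2.2) hB

theorem supDiam_nonneg (v : Fin n → PiLp p (fun _ : Fin d => ℝ)) : 0 ≤ supDiam v :=
  diam_nonneg (fun _ _ => dist_nonneg) _

theorem abs_sub_le_supDiam (v : Fin n → PiLp p (fun _ : Fin d => ℝ)) (x y : Fin n) (i : Fin d) :
    |v x i - v y i| ≤ supDiam v := by
  have h1 := le_diam (fun i j => dist (WithLp.ofLp (v i)) (WithLp.ofLp (v j)))
    (Finset.mem_univ x) (Finset.mem_univ y)
  exact (dist_le_pi_dist (WithLp.ofLp (v x)) (WithLp.ofLp (v y)) i).trans h1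

theorem gridIndex_of_supDiam_eq_zero (v : Fin n → PiLp p (fun _ : Fin d => ℝ)) (m j : ℕ)
    (ω : Fin d → unitInterval) (x : Fin n) (i : Fin d) (h : supDiam v = 0) :
    gridIndex v m j ω x i = 0 := by
  simp [gridIndex, h]

theorem gridIndex_eq (v : Fin n → PiLp p (fun _ : Fin d => ℝ)) (m j : ℕ)
    (ω : Fin d → unitInterval) (x : Fin n) (i : Fin d) (h : supDiam v ≠ 0) :
    gridIndex v m j ω x i =
      ⌊(v x i - ⨅ y, v y i) * (m : ℝ) ^ j / supDiam v - ((m ^ j : ℕ) : ℝ) * (ω i : ℝ)⌋ := by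
  rw [gridIndex]
  congr 1
  push_cast
  field_simp

theorem abs_sub_le_of_gridIndex_eq (v : Fin n → PiLp p (fun _ : Fin d => ℝ)) {m : ℕ} (hm : m ≠ 0)
    (j : ℕ) {ω : Fin d → unitInterval} {x y : Fin n} {i : Fin d}
    (h : gridIndex v m j ω x i = gridIndex v m j ω y i) :
    |v x i - v y i| ≤ supDiam v / (m : ℝ) ^ j := by
  have hmj : (0 : ℝ) < (m : ℝ) ^ j := pow_pos (by exact_mod_cast Nat.pos_of_ne_zero hm) j
  rcases (supDiam_nonneg v).eq_or_lt with h0 | h0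
  · rw [← h0, zero_div]
    exact (abs_sub_le_supDiam v x y i).trans h0.symm.le
  · rw [gridIndex_eq v m j ω x i h0.ne', gridIndex_eq v m j ω y i h0.ne'] at h
    have h1 := Int.abs_sub_lt_one_of_floor_eq_floor h
    have h2 : (v x i - ⨅ y, v y i) * (m : ℝ) ^ j / supDiam v - ((m ^ j : ℕ) : ℝ) * (ω i : ℝ) -
        ((v y i - ⨅ y, v y i) * (m : ℝ) ^ j / supDiam v - ((m ^ j : ℕ) : ℝ) * (ω i : ℝ)) =
        (v x i - v y i) * ((m : ℝ) ^ j / supDiam v) := by ring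
    rw [h2, abs_mul, abs_of_pos (div_pos hmj h0), ← mul_div_assoc, div_lt_one h0] at h1
    rw [le_div_iff₀ hmj]
    exact h1.le

theorem measurable_gridIndex (v : Fin n → PiLp p (fun _ : Fin d => ℝ)) (m j : ℕ) (x : Fin n) :
    Measurable fun ω => gridIndex v m j ω x := by
  refine measurable_pi_iff.2 fun i => ?_
  exact Int.measurable_floor.comp (by fun_prop)

theorem measurableSet_gridSetoid (v : Fin n → PiLp p (fun _ : Fin d => ℝ)) (m : ℕ)
    (ℓ : Fin (L + 1)) (x y : Fin n) : MeasurableSet {ω | gridSetoid v m ω ℓ x y} :=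
  (MeasurableSet.const _).union
    (measurableSet_eq_fun (measurable_gridIndex v m _ x) (measurable_gridIndex v m _ y))

theorem HierPartition.ext_part {V : Type} [Fintype V] [DecidableEq V] {P P' : HierPartition V L}
    (h : ∀ ℓ x, (P.level ℓ).part x = (P'.level ℓ).part x) : P = P' := by
  have key : ∀ {P P' : HierPartition V L}, (∀ ℓ x, (P.level ℓ).part x = (P'.level ℓ).part x) →
      ∀ ℓ, (P.level ℓ).parts ⊆ (P'.level ℓ).parts := by
    intro P P' h ℓ C hC
    obtain ⟨x, hx⟩ := (P.level ℓ).nonempty_of_mem_parts hC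
    rw [← (P.level ℓ).part_eq_of_mem hC hx, h]
    exact (P'.level ℓ).part_mem.2 (Finset.mem_univ x)
  have hlevel : P.level = P'.level := by
    funext ℓ
    exact Finpartition.ext (Finset.Subset.antisymm (key h ℓ) (key (fun ℓ x => (h ℓ x).symm) ℓ))
  cases P
  cases P'
  cases hlevel
  rfl

instance {V : Type} [Fintype V] [DecidableEq V] : Finite (HierPartition V L) :=
  Finite.of_injective (fun P ℓ x => (P.level ℓ).part x) fun _ _ h =>
    HierPartition.ext_part fun ℓ x => congrFun (congrFun h ℓ) x

/-- Union bound over coordinates, each reduced to the one-dimensional estimate by its marginal. If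
`supDiam v = 0`, all indices vanish and nothing is separated. -/
theorem volume_gridIndex_ne_le (v : Fin n → PiLp p (fun _ : Fin d => ℝ)) {m : ℕ} (hm : m ≠ 0)
    (j : ℕ) (x y : Fin n) :
    (volume : Measure (Fin d → unitInterval)).real
      {ω | gridIndex v m j ω x ≠ gridIndex v m j ω y} ≤
      (∑ i, |v x i - v y i|) * ((m : ℝ) ^ j / supDiam v) := by
  rcases (supDiam_nonneg v).eq_or_lt with h0 | h0
  · have hz : ∀ ω, gridIndex v m j ω x = gridIndex v m j ω y := fun ω => funext fun i => by
      rw [gridIndex_of_supDiam_eq_zero v m j ω x i h0.symm,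
        gridIndex_of_supDiam_eq_zero v m j ω y i h0.symm]
    simp only [hz, ne_eq, not_true_eq_false, Set.ofPred_false, measureReal_empty, ← h0, div_zero,
      mul_zero, le_refl]
  · let α : Fin n → Fin d → ℝ := fun x i => (v x i - ⨅ y, v y i) * (m : ℝ) ^ j / supDiam v
    let S : Fin d → Set unitInterval := fun i =>
      {t | ⌊α x i - ((m ^ j : ℕ) : ℝ) * (t : ℝ)⌋ ≠ ⌊α y i - ((m ^ j : ℕ) : ℝ) * (t : ℝ)⌋}
    have hsub : {ω | gridIndex v m j ω x ≠ gridIndex v m j ω y} ⊆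
        ⋃ i ∈ Finset.univ, (fun ω : Fin d → unitInterval => ω i) ⁻¹' S i := by
      intro ω hω
      obtain ⟨i, hi⟩ := Function.ne_iff.1 hω
      rw [gridIndex_eq v m j ω x i h0.ne', gridIndex_eq v m j ω y i h0.ne'] at hi
      exact Set.mem_biUnion (Finset.mem_univ i) hi
    refine (measureReal_mono hsub (measure_ne_top _ _)).trans
      ((measureReal_biUnion_finset_le _ _).trans ?_)
    rw [Finset.sum_mul]
    refine Finset.sum_le_sum fun i _ => ?_
    have hpre := (measurePreserving_eval (fun _ : Fin d => (volume : Measure unitInterval)) i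
      ).measureReal_preimage (measurableSet_floor_ne (α x i) (α y i) ((m ^ j : ℕ) : ℝ)).nullMeasurableSet
    refine hpre.le.trans ((volume_floor_ne_le _ _ (pow_ne_zero j hm)).trans ?_)
    have h2 : α x i - α y i = (v x i - v y i) * ((m : ℝ) ^ j / supDiam v) := by
      simp only [α]
      ring
    rw [h2, abs_mul, abs_of_nonneg (a := (m : ℝ) ^ j / supDiam v) (by positivity)]

variable [Fact (1 ≤ p)]

theorem supDiam_le_diam (v : Fin n → PiLp p (fun _ : Fin d => ℝ)) :
    supDiam v ≤ diam (pointDist v) Finset.univ := by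
  refine diam_le (diam_nonneg (fun _ _ => dist_nonneg) _) fun x _ y _ => ?_
  refine le_trans ?_ (le_diam (pointDist v) (Finset.mem_univ x) (Finset.mem_univ y))
  have := norm_ofLp_le p (v x - v y)
  rwa [pointDist, dist_eq_norm, dist_eq_norm, ← WithLp.ofLp_sub]

theorem mem_part_gridPartition [NeZero n] [NeZero m] (v : Fin n → PiLp p (fun _ : Fin d => ℝ))
    (ω : Fin d → unitInterval) (ℓ : Fin (L + 1)) (x y : Fin n) :
    y ∈ ((gridPartition v m L ω).level ℓ).part x ↔ gridSetoid v m ω ℓ x y := by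
  classical
  exact Finpartition.mem_part_ofSetoid_iff_rel

theorem part_gridPartition_eq_iff [NeZero n] [NeZero m]
    (v : Fin n → PiLp p (fun _ : Fin d => ℝ)) (ω : Fin d → unitInterval) (ℓ : Fin (L + 1))
    (x y : Fin n) : ((gridPartition v m L ω).level ℓ).part x =
      ((gridPartition v m L ω).level ℓ).part y ↔ gridSetoid v m ω ℓ x y := by
  rw [eq_comm, ← Finpartition.mem_part_iff_part_eq_part _ (Finset.mem_univ y) (Finset.mem_univ x),
    mem_part_gridPartition]

theorem gridSetoid_of_mem_parts [NeZero n] [NeZero m] {v : Fin n → PiLp p (fun _ : Fin d => ℝ)}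
    {ω : Fin d → unitInterval} {ℓ : Fin (L + 1)} {C : Finset (Fin n)}
    (hC : C ∈ ((gridPartition v m L ω).level ℓ).parts) {x y : Fin n} (hx : x ∈ C) (hy : y ∈ C) :
    gridSetoid v m ω ℓ x y := by
  rw [← mem_part_gridPartition, Finpartition.part_eq_of_mem _ hC hx]
  exact hy

/-- There are finitely many partitions, so only preimages of points matter, and each is a finite
intersection of conditions on which pairs share a cell. -/
theorem measurable_gridPartition [NeZero n] [NeZero m]
    (v : Fin n → PiLp p (fun _ : Fin d => ℝ)) : Measurable (gridPartition v m L) := by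
  refine measurable_to_countable' fun P => ?_
  have h : gridPartition v m L ⁻¹' {P} =
      ⋂ ℓ, ⋂ x, ⋂ y, {ω | gridSetoid v m ω ℓ x y ↔ y ∈ (P.level ℓ).part x} := by
    ext ω
    simp only [Set.mem_preimage, Set.mem_singleton_iff, Set.mem_iInter, Set.mem_ofPred_eq]
    constructor
    · rintro rfl ℓ x y
      rw [mem_part_gridPartition]
    · refine fun h => HierPartition.ext_part fun ℓ x => ?_
      ext y
      rw [mem_part_gridPartition, h]
  rw [h]
  refine MeasurableSet.iInter fun ℓ => MeasurableSet.iInter fun x => MeasurableSet.iInter fun y =>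
    ?_
  by_cases hy : y ∈ (P.level ℓ).part x
  · simpa only [hy, iff_true] using measurableSet_gridSetoid v m ℓ x y
  · simpa only [hy, iff_false, Set.compl_ofPred] using (measurableSet_gridSetoid v m ℓ x y).compl

theorem exists_gridPartition_of_ne_zero [NeZero n] [NeZero m]
    {v : Fin n → PiLp p (fun _ : Fin d => ℝ)} {P : HierPartition (Fin n) L}
    (hP : gridDistribution v m L {P} ≠ 0) : ∃ ω, gridPartition v m L ω = P := by
  rw [gridDistribution, Measure.map_apply (measurable_gridPartition v) (measurableSet_singleton P)]
    at hP
  exact nonempty_of_measure_ne_zero hP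

/-- Below the root a cell splits into `m` index values per coordinate. Directly under the root the
grid is not aligned with the box: the rescaled coordinates fill an interval of length at most `m`,
which can meet `m + 1` unit cells. This is the source of `m + 1` in the degree. -/
theorem exists_gridIndex_window [NeZero n] [NeZero m] (v : Fin n → PiLp p (fun _ : Fin d => ℝ))
    (ω : Fin d → unitInterval) (ℓ : Fin L) {C : Finset (Fin n)}
    (hC : C ∈ ((gridPartition v m L ω).level ℓ.succ).parts) :
    ∃ z : Fin d → ℤ, ∀ x ∈ C, ∀ i,
      gridIndex v m (L - (ℓ.castSucc : ℕ)) ω x i ∈ Finset.Icc (z i) (z i + m) := by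
  have hm : 0 < (m : ℤ) := by exact_mod_cast Nat.pos_of_ne_zero (NeZero.ne m)
  have hℓ := ℓ.isLt
  simp only [Finset.mem_Icc]
  by_cases hlast : ℓ.succ = Fin.last L
  · have hj : L - (ℓ.castSucc : ℕ) = 1 := by
      have := congrArg Fin.val hlast
      simp only [Fin.val_castSucc, Fin.val_succ, Fin.val_last] at this ⊢
      omega
    rw [hj]
    rcases (supDiam_nonneg v).eq_or_lt with h0 | h0
    · refine ⟨0, fun x _ i => ?_⟩
      rw [gridIndex_of_supDiam_eq_zero v m 1 ω x i h0.symm]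
      simp
    · refine ⟨fun i => ⌊-(((m ^ 1 : ℕ) : ℝ) * (ω i : ℝ))⌋, fun x _ i => ?_⟩
      have hbdd : BddBelow (Set.range fun y => v y i) := (Set.finite_range _).bddBelow
      obtain ⟨y, hy⟩ := exists_eq_ciInf_of_finite (f := fun y => v y i)
      have h1 : 0 ≤ v x i - ⨅ y, v y i := sub_nonneg.2 (ciInf_le hbdd x)
      have h2 : v x i - ⨅ y, v y i ≤ supDiam v := by
        rw [← hy]
        exact (le_abs_self _).trans (abs_sub_le_supDiam v x y i)
      have h3 : 0 ≤ (v x i - ⨅ y, v y i) * (m : ℝ) ^ 1 / supDiam v := by positivity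
      have h4 : (v x i - ⨅ y, v y i) * (m : ℝ) ^ 1 / supDiam v ≤ m := by
        rw [div_le_iff₀ h0, pow_one, mul_comm]
        exact mul_le_mul_of_nonneg_left h2 (Nat.cast_nonneg m)
      rw [gridIndex_eq v m 1 ω x i h0.ne']
      constructor
      · exact Int.floor_le_floor (by linarith)
      · rw [← Int.floor_add_natCast]
        exact Int.floor_le_floor (by linarith)
  · obtain ⟨x₀, hx₀⟩ := Finpartition.nonempty_of_mem_parts _ hC
    refine ⟨fun i => m * gridIndex v m (L - (ℓ.succ : ℕ)) ω x₀ i, fun x hx i => ?_⟩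
    have hj : L - (ℓ.castSucc : ℕ) = (L - (ℓ.succ : ℕ)) + 1 := by
      simp only [Fin.val_castSucc, Fin.val_succ]
      omega
    have heq := (gridSetoid_of_mem_parts hC hx₀ hx).resolve_left hlast
    rw [hj]
    simp only [heq, gridIndex_succ v m (L - (ℓ.succ : ℕ)) (NeZero.ne m) ω x i]
    set k := gridIndex v m (L - (ℓ.succ : ℕ) + 1) ω x i
    have h1 := Int.emod_add_mul_ediv k m
    have h2 := Int.emod_nonneg k hm.ne'
    have h3 := Int.emod_lt_of_pos k hm
    constructor <;> linarith

theorem card_children_gridPartition_le [NeZero n] [NeZero m]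
    (v : Fin n → PiLp p (fun _ : Fin d => ℝ)) (ω : Fin d → unitInterval) (ℓ : Fin L)
    {C : Finset (Fin n)} (hC : C ∈ ((gridPartition v m L ω).level ℓ.succ).parts) :
    ((gridPartition v m L ω).children ℓ C).card ≤ (m + 1) ^ d := by
  classical
  obtain ⟨z, hz⟩ := exists_gridIndex_window v ω ℓ hC
  have hcard : (Fintype.piFinset fun i => Finset.Icc (z i) (z i + m)).card = (m + 1) ^ d := by
    rw [Fintype.card_piFinset]
    have : ∀ i, (Finset.Icc (z i) (z i + m)).card = m + 1 := by
      intro i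
      rw [Int.card_Icc]
      omega
    simp [this]
  rw [← hcard]
  have hne : ∀ C' ∈ (gridPartition v m L ω).children ℓ C, C'.Nonempty := fun C' hC' =>
    Finpartition.nonempty_of_mem_parts _ (HierPartition.mem_parts_of_mem_children hC')
  -- Label a subcell by the index of any of its points; equal labels mean the same cell, so `f` is
  -- injective on subcells.
  let f : Finset (Fin n) → Fin d → ℤ := fun C' =>
    if h : C'.Nonempty then gridIndex v m (L - (ℓ.castSucc : ℕ)) ω h.choose else 0
  refine Finset.card_le_card_of_injOn f (fun C' hC' => ?_) fun A hA B hB hAB => ?_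
  · have h := hne C' hC'
    simp only [f, dif_pos h, Finset.mem_coe, Fintype.mem_piFinset]
    exact hz _ ((Finset.mem_filter.1 hC').2 h.choose_spec)
  · have hA' := hne A hA
    have hB' := hne B hB
    simp only [f, dif_pos hA', dif_pos hB'] at hAB
    have hAp := HierPartition.mem_parts_of_mem_children hA
    have hBp := HierPartition.mem_parts_of_mem_children hB
    rw [← Finpartition.part_eq_of_mem _ hAp hA'.choose_spec,
      ← Finpartition.part_eq_of_mem _ hBp hB'.choose_spec, part_gridPartition_eq_iff]
    exact Or.inr hAB

theorem pointDist_le_of_gridSetoid (hd : 1 ≤ d) (hp : p = 1 ∨ p = 2 ∨ p = ⊤) [NeZero m]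
    (v : Fin n → PiLp p (fun _ : Fin d => ℝ)) {ω : Fin d → unitInterval} {ℓ : Fin (L + 1)}
    {x y : Fin n} (h : gridSetoid v m ω ℓ x y) :
    pointDist v x y ≤ scale (pointDist v) (1 / (m : ℝ)) d L ℓ := by
  have hd' : (1 : ℝ) ≤ d := by exact_mod_cast hd
  have hmj : (0 : ℝ) < (m : ℝ) ^ (L - (ℓ : ℕ)) :=
    pow_pos (by exact_mod_cast Nat.pos_of_ne_zero (NeZero.ne m)) _
  have hdiam : 0 ≤ diam (pointDist v) Finset.univ := diam_nonneg (fun _ _ => dist_nonneg) _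
  rcases h with rfl | h
  · have h1 := le_diam (pointDist v) (Finset.mem_univ x) (Finset.mem_univ y)
    simp only [scale, Fin.val_last, Nat.sub_self, pow_zero, mul_one]
    nlinarith
  · obtain ⟨e, he0, hed, he, -⟩ := exists_norm_comparison p hp hd
    have h0 : 0 ≤ supDiam v / (m : ℝ) ^ (L - (ℓ : ℕ)) := div_nonneg (supDiam_nonneg v) hmj.le
    have h1 : ‖WithLp.ofLp (v x - v y)‖ ≤ supDiam v / (m : ℝ) ^ (L - (ℓ : ℕ)) :=
      (pi_norm_le_iff_of_nonneg h0).2 fun i =>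
        abs_sub_le_of_gridIndex_eq v (NeZero.ne m) _ (congrFun h i)
    calc pointDist v x y = ‖v x - v y‖ := dist_eq_norm _ _
      _ ≤ e * ‖WithLp.ofLp (v x - v y)‖ := he _
      _ ≤ d * (diam (pointDist v) Finset.univ / (m : ℝ) ^ (L - (ℓ : ℕ))) := by
          refine mul_le_mul hed (h1.trans ?_) (norm_nonneg _) (by linarith)
          exact div_le_div_of_nonneg_right (supDiam_le_diam v) hmj.le
      _ = scale (pointDist v) (1 / (m : ℝ)) d L ℓ := by
          rw [scale, one_div, inv_pow]
          ring

/-- The same constant `e` enters twice: the `ℓ_p` diameter is at most `e * supDiam v`, and `e` times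
the `ℓ_1` distance is at most `d` times the `ℓ_p` distance. So `e` cancels and the loss is one
factor `d`; the other factor of `d²` compensates `γ = d` in the scale. -/
theorem gridDistribution_cut_le (hd : 1 ≤ d) (hp : p = 1 ∨ p = 2 ∨ p = ⊤) [NeZero n] [NeZero m]
    (v : Fin n → PiLp p (fun _ : Fin d => ℝ)) (x y : Fin n) (ℓ : Fin (L + 1)) :
    (gridDistribution v m L).real {P | (P.level ℓ).part x ≠ (P.level ℓ).part y} ≤
      (d : ℝ) ^ 2 * (pointDist v x y / scale (pointDist v) (1 / (m : ℝ)) d L ℓ) := by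
  have hd0 : (0 : ℝ) < d := by exact_mod_cast hd
  have hmj : (0 : ℝ) < (m : ℝ) ^ (L - (ℓ : ℕ)) :=
    pow_pos (by exact_mod_cast Nat.pos_of_ne_zero (NeZero.ne m)) _
  have hdiam : 0 ≤ diam (pointDist v) Finset.univ := diam_nonneg (fun _ _ => dist_nonneg) _
  have hρ : 0 ≤ pointDist v x y := dist_nonneg
  obtain ⟨e, he0, -, he, hsum⟩ := exists_norm_comparison p hp hd
  have hsub : gridPartition v m L ⁻¹' {P | (P.level ℓ).part x ≠ (P.level ℓ).part y} ⊆
      {ω | gridIndex v m (L - (ℓ : ℕ)) ω x ≠ gridIndex v m (L - (ℓ : ℕ)) ω y} := by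
    intro ω hω heq
    exact hω ((part_gridPartition_eq_iff v ω ℓ x y).2 (Or.inr heq))
  rw [gridDistribution, map_measureReal_apply (measurable_gridPartition v) trivial]
  refine (measureReal_mono hsub (measure_ne_top _ _)).trans
    ((volume_gridIndex_ne_le v (NeZero.ne m) _ x y).trans ?_)
  have hs : scale (pointDist v) (1 / (m : ℝ)) d L ℓ =
      d * (diam (pointDist v) Finset.univ / (m : ℝ) ^ (L - (ℓ : ℕ))) := by
    rw [scale, one_div, inv_pow]
    ring
  have h1 : diam (pointDist v) Finset.univ ≤ e * supDiam v := by
    refine diam_le (mul_nonneg he0 (supDiam_nonneg v)) fun x _ y _ => ?_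
    calc pointDist v x y = ‖v x - v y‖ := dist_eq_norm _ _
      _ ≤ e * ‖WithLp.ofLp (v x - v y)‖ := he _
      _ ≤ e * supDiam v := by
        refine mul_le_mul_of_nonneg_left ?_ he0
        rw [WithLp.ofLp_sub, ← dist_eq_norm]
        exact le_diam (fun i j => dist (WithLp.ofLp (v i)) (WithLp.ofLp (v j)))
          (Finset.mem_univ x) (Finset.mem_univ y)
  have h2 : (∑ i, |v x i - v y i|) * e ≤ d * pointDist v x y := by
    rw [pointDist, dist_eq_norm]
    exact hsum (v x - v y)
  rcases (supDiam_nonneg v).eq_or_lt with h0 | h0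
  · rw [← h0, div_zero, mul_zero]
    refine mul_nonneg (by positivity) (div_nonneg hρ ?_)
    rw [hs]
    positivity
  · have hpos : 0 < diam (pointDist v) Finset.univ := h0.trans_le (supDiam_le_diam v)
    have h3 : (∑ i, |v x i - v y i|) * diam (pointDist v) Finset.univ ≤
        d * pointDist v x y * supDiam v := by
      calc (∑ i, |v x i - v y i|) * diam (pointDist v) Finset.univ
          ≤ (∑ i, |v x i - v y i|) * (e * supDiam v) :=
            mul_le_mul_of_nonneg_left h1 (Finset.sum_nonneg fun i _ => abs_nonneg _)
        _ = ((∑ i, |v x i - v y i|) * e) * supDiam v := by ring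
        _ ≤ d * pointDist v x y * supDiam v := mul_le_mul_of_nonneg_right h2 h0.le
    have h4 : (d : ℝ) ^ 2 * (pointDist v x y / scale (pointDist v) (1 / (m : ℝ)) d L ℓ) =
        (d * pointDist v x y * supDiam v) *
          ((m : ℝ) ^ (L - (ℓ : ℕ)) / (supDiam v * diam (pointDist v) Finset.univ)) := by
      rw [hs]
      field_simp
    have h5 : (∑ i, |v x i - v y i|) * ((m : ℝ) ^ (L - (ℓ : ℕ)) / supDiam v) =
        ((∑ i, |v x i - v y i|) * diam (pointDist v) Finset.univ) *
          ((m : ℝ) ^ (L - (ℓ : ℕ)) / (supDiam v * diam (pointDist v) Finset.univ)) := by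
      field_simp
    rw [h4, h5]
    exact mul_le_mul_of_nonneg_right h3 (by positivity)

/-- The randomly shifted grid is distance-preserving with approximation `d`. -/
theorem isDistancePreserving_gridDistribution (hd : 1 ≤ d) (hm : 2 ≤ m)
    (hp : p = 1 ∨ p = 2 ∨ p = ⊤) [NeZero n] [NeZero m]
    (v : Fin n → PiLp p (fun _ : Fin d => ℝ)) :
    IsDistancePreserving (pointDist v) (gridDistribution v m L) (1 / (m : ℝ)) ((d : ℝ) ^ 2)
      (((m : ℝ) + 1) ^ d) d := by
  have hd' : (1 : ℝ) ≤ d := by exact_mod_cast hd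
  have hm' : (2 : ℝ) ≤ m := by exact_mod_cast hm
  refine ⟨Measure.isProbabilityMeasure_map (measurable_gridPartition v).aemeasurable,
    by positivity, ?_, by positivity, by positivity, hd', fun P hP ℓ C hC => ?_,
    fun P hP ℓ C hC => ?_, fun x y ℓ => gridDistribution_cut_le hd hp v x y ℓ⟩
  · rw [div_lt_one (by linarith)]
    linarith
  · obtain ⟨ω, rfl⟩ := exists_gridPartition_of_ne_zero hP
    exact_mod_cast card_children_gridPartition_le v ω ℓ hC
  · obtain ⟨ω, rfl⟩ := exists_gridPartition_of_ne_zero hP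
    refine diam_le (scale_nonneg (fun _ _ => dist_nonneg) (by positivity) (by linarith) ℓ)
      fun x hx y hy => ?_
    exact pointDist_le_of_gridSetoid hd hp v (gridSetoid_of_mem_parts hC hx hy)

end Grid

end PartitionMST

/-! ### Choice of the constants -/

theorem theorem2 :
    -- the approximation guarantee, for every distance-preserving family
    (∃ c₁ c₂ : ℝ, 0 < c₁ ∧ 0 < c₂ ∧
      ∀ κ : ℝ, 0 < κ → ∃ K : ℝ, 0 < K ∧
        ∀ (p : ENNReal) [Fact (1 ≤ p)], (p = 1 ∨ p = 2 ∨ p = ⊤) →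
        ∀ (d n : ℕ), 1 ≤ n → ∀ (v : Fin n → PiLp p (fun _ : Fin d => ℝ)),
        ∀ (η : ℝ), 0 < η → η ≤ 3 →
        ∀ (L : ℕ), 1 ≤ L → ∀ (a b c γ : ℝ)
          (D : MeasureTheory.Measure (PartitionMST.HierPartition (Fin n) L)),
          PartitionMST.IsDistancePreserving (PartitionMST.pointDist v) D a b c γ →
        ∀ (k : ℕ), K * Real.log n ≤ k →
          1 - (n : ℝ) ^ (-κ) ≤
            (MeasureTheory.Measure.pi (fun _ : Fin k => D)).real
              {P | PartitionMST.Succeeds v (min (η / (6 * c₁ * L * b)) (η / (3 * c₂)))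
                (PartitionMST.scale (PartitionMST.pointDist v) a γ L) η P}) ∧
    -- the randomly shifted grid is such a family, with the parameters used by the algorithm
    (∀ (p : ENNReal) [Fact (1 ≤ p)], (p = 1 ∨ p = 2 ∨ p = ⊤) →
      ∀ (d n m L : ℕ) [NeZero n] [NeZero m], 1 ≤ d → 2 ≤ m → 1 ≤ L →
      ∀ (v : Fin n → PiLp p (fun _ : Fin d => ℝ)),
        ∃ γ : ℝ, γ ≤ d ∧
          PartitionMST.IsDistancePreserving (PartitionMST.pointDist v)
            (PartitionMST.gridDistribution v m L) (1 / (m : ℝ)) ((d : ℝ) ^ 2)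
            (((m : ℝ) + 1) ^ d) γ) := by
  -- `K` makes `2^{-k} ≤ n^{-(κ + 2)}`, which pays for the `n²` pairs. With `c₁ = 1`, the bounds `η
  -- ≤ 3` and `L ≥ 1` give `b ε ≤ 1/2`; with `c₂ = 6`, `ε ≤ η / 18 ≤ 1/6`.
  refine ⟨⟨1, 6, one_pos, by norm_num, fun κ hκ => ⟨(κ + 2) / Real.log 2,
    div_pos (by linarith) (Real.log_pos (by norm_num)), ?_⟩⟩, ?_⟩
  · intro p _ _ d n hn v η hη hη3 L hL a b c γ D hD k hk
    have hL' : (1 : ℝ) ≤ L := by exact_mod_cast hL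
    have hb := hD.b_pos
    have hden : 0 < 6 * 1 * (L : ℝ) * b := by positivity
    set ε := min (η / (6 * 1 * L * b)) (η / (3 * 6)) with hεdef
    have hε0 : 0 ≤ ε := le_min (by positivity) (by positivity)
    have hε1 : ε ≤ η / (3 * 6) := min_le_right _ _
    have hε2 : ε ≤ 1 / 6 := by linarith
    have hbε : b * ε ≤ 1 / 2 := by
      have h1 : ε * (6 * 1 * L * b) ≤ η := (le_div_iff₀ hden).1 (min_le_left _ _)
      have h2 : 0 ≤ b * ε := by positivity
      nlinarith
    refine le_trans ?_ (hD.prob_succeeds_ge hn v hε0 (by nlinarith) hη.le ?_ hbε k)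
    · linarith [PartitionMST.sq_mul_half_pow_le hn hk]
    -- It remains to see `(1 + ε)(1 + 8ε) = 1 + 9ε + 8ε² ≤ 1 + 18ε ≤ 1 + η`, using `ε ≤ 1/6`.
    · have h1 : ε * (1 + η) ≤ ε * 4 := mul_le_mul_of_nonneg_left (by linarith) hε0
      have h2 : (1 + ε) * (1 + 2 * (ε * (1 + η))) ≤ (1 + ε) * (1 + 2 * (ε * 4)) :=
        mul_le_mul_of_nonneg_left (by linarith) (by linarith)
      nlinarith
  · intro p _ hp d n m L _ _ hd hm _ v
    exact ⟨d, le_rfl, PartitionMST.isDistancePreserving_gridDistribution hd hm hp v⟩
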